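/- **Setup.** Let $(\mathcal Y,d)$ be a metric space with its Borel $\sigma$-field. Let $Y_0,Y_1$ be random elements of $\mathcal Y$ (potential outcomes), $S_0,S_1\in\{0,1\}$ (potential selection indicators) and $D\in\{0,1\}$ (treatment) be defined on one probability space, such that $D$ is independent of $(Y_1,Y_0,S_1,S_0)$ (random assignment) and $S_1\ge S_0$ almost surely (monotonicity). The observed vector is $(D,S,Y)$, where $S=S_1D+S_0(1-D)$, $Y=Y_1D+Y_0(1-D)$ if $S=1$, and $Y=\mathrm{NA}$ if $S=0$; let $P$ be its law. Assume $P(D=1)>0$ and $P(D=0,S=1)>0$. Let $\Psi:\mathcal Y\to\mathcal H$ be an isometric (hence injective) map into a separable real Hilbert space $\mathcal H$ such that $\Psi(\mathcal Y)$ is closed and convex. Assume $E[\|\Psi(Y)\|^2\mathbf 1\{S=1\}]<\infty$ and that, for every $u\in\mathcal H$ with $\|u\|=1$, the conditional distribution of $\langle u,\Psi(Y)\rangle$ given $D=1,S=1$ is continuous (has no atoms). Put $$p=\frac{P(S=1\mid D=0)}{P(S=1\mid D=1)},\qquad \mu(A)=P(\Psi(Y)\in A\mid D=1,S=1),$$ $$\mathcal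 I_1=\Big\{\tfrac1p\int_{\mathcal H}x\,d\nu(x):\ \nu \text{ a measure on } \mathcal H,\ 0\le\nu(A)\le\mu(A)\text{ for all measurable }A,\ \nu(\mathcal H)=p\Big\},$$ $$\sigma(u)=E\big[\langle u,\Psi(Y)\rangle\mid D=1,S=1,\langle u,\Psi(Y)\rangle\ge Q_u(1-p)\big],\qquad \mathcal S_1=\bigcap_{\|u\|=1}\{v\in\mathcal H:\langle u,v\rangle\le\sigma(u)\},$$ where $Q_u(q)=\inf\{t\in\mathbb R: P(\langle u,\Psi(Y)\rangle\le t\mid D=1,S=1)\ge q\}\in[-\infty,\infty]$ is the conditional quantile function of $\langle u,\Psi(Y)\rangle$ given $D=1,S=1$ (so $Q_u(0)=-\infty$). For a set $\Gamma$ of parameters $\gamma$ under which the data have law $P_\gamma$, the *sharp identified set* of $\theta=\theta(\gamma)$ at $P$ is $\{\theta(\gamma):\gamma\in\Gamma,\ P_\gamma=P\}$, and a *valid identified set* is any superset of it. Here $\Gamma$ is the set of all laws $\gamma$ of a latent vector $(D,(Y_1,Y_0,S_1,S_0))$ satisfying random assignment and monotonicity, and $P_\gamma$ is the resulting law of $(D,S,Y)$.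 The parameters are $E[\Psi(Y_1)\mid S_1=S_0=1]$ and the Fréchet mean $\mu_{1\oplus}=\arg\min_{y\in\mathcal Y}E[d^2(y,Y_1)\mid S_1=S_0=1]$. **Theorem.** The set $\mathcal I_1$ is the sharp identified set of $E[\Psi(Y_1)\mid S_1=S_0=1]$ at $P$. It is also the sharp identified set at $\mu$ of $\theta(\nu,\eta)=\frac1p\int x\,d\nu(x)$ in the mixture model of all pairs of nonnegative measures $(\nu,\eta)$ on $\mathcal H$ such that $\nu+\eta$ is a probability measure and $\nu(\mathcal H)=p$, with $P_{(\nu,\eta)}=\nu+\eta$. Moreover: (i) $\overline{\mathrm{conv}}\,\mathcal I_1=\mathcal S_1$; in particular, $\mathcal S_1$ is a valid identified set of $E[\Psi(Y_1)\mid S_1=S_0=1]$. (ii) For every $\gamma\in\Gamma$ with $P_\gamma=P$ the minimizer $\mu_{1\oplus}$ exists and is unique, and $\Psi^{-1}(\mathcal S_1)$ is a valid identified set of $\mu_{1\oplus}$. (iii) If $\Psi(Y)$ is finite-dimensional, i.e. there is a finite-dimensional linear subspace $V\subset\mathcal H$ with $\mu(V)=1$, then $\mathcal I_1=\mathcal S_1$,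 $\mathcal S_1$ is the sharp identified set of $E[\Psi(Y_1)\mid S_1=S_0=1]$, and $\Psi^{-1}(\mathcal S_1)$ is the sharp identified set of $\mu_{1\oplus}$. -/

import Mathlib

open MeasureTheory ProbabilityTheory Set
open scoped ENNReal

noncomputable section

namespace LeeBounds

/-! ### Identified sets -/

/-- A statistical model consists of a set `model` of parameters `γ`, and of the distribution
`law γ` of the data under `γ`.  The sharp identified set of `θ` at the data distribution `P` is
`{θ γ : γ ∈ model, law γ = P}`. -/
def sharpIdentifiedSet {Γ Q Θ : Type*} (model : Set Γ) (law : Γ → Q) (θ : Γ → Θ) (P : Q) :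
    Set Θ :=
  θ '' {γ | γ ∈ model ∧ law γ = P}

/-- A valid identified set is a superset of the sharp identified set. -/
def IsValidIdentifiedSet {Γ Q Θ : Type*} (model : Set Γ) (law : Γ → Q) (θ : Γ → Θ) (P : Q)
    (T : Set Θ) : Prop :=
  sharpIdentifiedSet model law θ P ⊆ T

/-- `T` is the sharp identified set. -/
def IsSharpIdentifiedSet {Γ Q Θ : Type*} (model : Set Γ) (law : Γ → Q) (θ : Γ → Θ) (P : Q)
    (T : Set Θ) : Prop :=
  T = sharpIdentifiedSet model law θ P

/-! ### The sample selection model -/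

/-- Values of the latent vector `(D, (Y₁, Y₀, S₁, S₀))`. -/
abbrev Latent (𝒴 : Type*) : Type _ := Bool × (𝒴 × 𝒴 × Bool × Bool)

/-- Values of the observed vector `(D, S, Y)`; the value `Sum.inr ()` of `Y` is `NA`. -/
abbrev Observed (𝒴 : Type*) : Type _ := Bool × Bool × (𝒴 ⊕ Unit)

/-- The selection model `S = S₁ D + S₀ (1 - D)`, and `Y = Y₁ D + Y₀ (1 - D)` if `S = 1`,
`Y = NA` if `S = 0`. -/
def observe {𝒴 : Type*} : Latent 𝒴 → Observed 𝒴
  | (d, y₁, y₀, s₁, s₀) =>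
    let s := if d then s₁ else s₀
    let y := if d then y₁ else y₀
    (d, s, if s then Sum.inl y else Sum.inr ())

/-- The laws of latent vectors that satisfy random assignment and monotonicity. -/
def selectionModel (𝒴 : Type*) [MeasurableSpace 𝒴] : Set (Measure (Latent 𝒴)) :=
  {γ | IsProbabilityMeasure γ ∧
    IndepFun (fun x : Latent 𝒴 => x.1) (fun x : Latent 𝒴 => x.2) γ ∧
    ∀ᵐ x ∂γ, x.2.2.2.2 ≤ x.2.2.2.1}

/-- The law of the observed vector under a law of the latent vector. -/
def observedLaw {𝒴 : Type*} [MeasurableSpace 𝒴] (γ : Measure (Latent 𝒴)) :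
    Measure (Observed 𝒴) :=
  γ.map observe

/-- The conditional law of `Y₁` given `S₁ = S₀ = 1`. -/
def alwaysObservedLaw {𝒴 : Type*} [MeasurableSpace 𝒴] (γ : Measure (Latent 𝒴)) : Measure 𝒴 :=
  (γ[|{x | x.2.2.2.1 = true ∧ x.2.2.2.2 = true}]).map (fun x => x.2.1)

/-! ### Fréchet means -/

/-- `y` minimizes `z ↦ E[d(z, Y)²]`, where `Y` has law `ρ`. -/
def IsFrechetMean {𝒴 : Type*} [MetricSpace 𝒴] [MeasurableSpace 𝒴] (ρ : Measure 𝒴) (y : 𝒴) :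
    Prop :=
  ∀ z : 𝒴, ∫⁻ w, edist y w ^ 2 ∂ρ ≤ ∫⁻ w, edist z w ^ 2 ∂ρ

/-- The Fréchet mean of `ρ`, that is, the minimizer of `z ↦ E[d(z, Y)²]`
(meaningful when there is exactly one minimizer). -/
def frechetMean {𝒴 : Type*} [MetricSpace 𝒴] [MeasurableSpace 𝒴] [Nonempty 𝒴]
    (ρ : Measure 𝒴) : 𝒴 :=
  Classical.epsilon (IsFrechetMean ρ)

/-! ### The parameters of interest -/

/-- `E[Ψ(Y₁) | S₁ = S₀ = 1]`. -/
def alwaysObservedMean {𝒴 H : Type*} [MeasurableSpace 𝒴] [NormedAddCommGroup H]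
    [InnerProductSpace ℝ H] (Ψ : 𝒴 → H) (γ : Measure (Latent 𝒴)) : H :=
  ∫ y, Ψ y ∂(alwaysObservedLaw γ)

/-- The Fréchet mean `μ₁⊕` of `Y₁` given `S₁ = S₀ = 1`. -/
def alwaysObservedFrechetMean {𝒴 : Type*} [MetricSpace 𝒴] [MeasurableSpace 𝒴] [Nonempty 𝒴]
    (γ : Measure (Latent 𝒴)) : 𝒴 :=
  frechetMean (alwaysObservedLaw γ)

/-! ### Quantities determined by the law `P` of the observed data -/

/-- `Ψ(Y)` for an observed outcome, with the value `0` when the outcome is missing. -/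
def embedObserved {𝒴 H : Type*} [NormedAddCommGroup H] (Ψ : 𝒴 → H) : 𝒴 ⊕ Unit → H :=
  Sum.elim Ψ (fun _ => 0)

/-- `p = P(S = 1 | D = 0) / P(S = 1 | D = 1)`. -/
def trimming {𝒴 : Type*} [MeasurableSpace 𝒴] (P : Measure (Observed 𝒴)) : ℝ :=
  (P[|{o | o.1 = false}]).real {o | o.2.1 = true} /
    (P[|{o | o.1 = true}]).real {o | o.2.1 = true}

/-- `μ`, the conditional law of `Ψ(Y)` given `D = 1` and `S = 1`. -/
def embeddedLaw {𝒴 H : Type*} [MeasurableSpace 𝒴] [NormedAddCommGroup H] [MeasurableSpace H]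
    (Ψ : 𝒴 → H) (P : Measure (Observed 𝒴)) : Measure H :=
  (P[|{o | o.1 = true ∧ o.2.1 = true}]).map (fun o => embedObserved Ψ o.2.2)

section Hilbert

variable {H : Type*} [NormedAddCommGroup H] [InnerProductSpace ℝ H] [MeasurableSpace H]

/-- `I₁`: the vectors `(1/p) ∫ x dν(x)` with `0 ≤ ν ≤ μ` and `ν(H) = p`. -/
def setI (μ : Measure H) (p : ℝ) : Set H :=
  {v | ∃ ν : Measure H, (∀ A, MeasurableSet A → ν A ≤ μ A) ∧ ν univ = ENNReal.ofReal p ∧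
    v = (1 / p) • ∫ x, x ∂ν}

/-- The quantile `inf {t ∈ ℝ : ρ((-∞, t]) ≥ q}`, an extended real number (it is `-∞` at `q = 0`). -/
def quantile (ρ : Measure ℝ) (q : ℝ) : EReal :=
  sInf ((fun t : ℝ => (t : EReal)) '' {t : ℝ | q ≤ ρ.real (Iic t)})

/-- `σ(u) = E[⟨u, X⟩ | ⟨u, X⟩ ≥ Q(1 - p)]` for `X` of law `μ`, where `Q` is the quantile
function of `⟨u, X⟩`. -/
def trimmedMean (μ : Measure H) (p : ℝ) (u : H) : ℝ :=
  ∫ x, inner ℝ u x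
    ∂(μ[|{x | quantile (μ.map (fun x => inner ℝ u x)) (1 - p) ≤ ((inner ℝ u x : ℝ) : EReal)}])

/-- `S₁ = ⋂_{‖u‖ = 1} {v : ⟨u, v⟩ ≤ σ(u)}`. -/
def setS (μ : Measure H) (p : ℝ) : Set H :=
  ⋂ u ∈ {u : H | ‖u‖ = 1}, {v : H | inner ℝ u v ≤ trimmedMean μ p u}

/-- The mixture parameters `(ν, η)` in which `ν + η` is a probability measure on `H` and
`ν(H) = p`. -/
def mixtureModel (H : Type*) [MeasurableSpace H] (p : ℝ) : Set (Measure H × Measure H) :=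
  {γ | IsProbabilityMeasure (γ.1 + γ.2) ∧ γ.1 univ = ENNReal.ofReal p}

end Hilbert

end LeeBounds

end

/-! The mean and the Fréchet mean depend on the latent law only through the conditional law of `Y₁`
given `S₁ = S₀ = 1`, so the core is to find which conditional laws are compatible with `P`. Random
assignment makes the latent law a product `δ.prod κ`, and `P` sees `κ` only through the selected
outcomes of each arm. By monotonicity the always-selected have share `p` among those with `S₁ = 1`,
so their law is `N / p` with `N` dominated by the law of `Y₁` given `S₁ = 1`
(`exists_le_of_latentLaw`). Conversely, any such `N` is realized by mixing three strata: always
selected, selected only if treated, never selected (`exists_latentLaw_of_le`). Pushing forward by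
`Ψ` and integrating gives `I₁`.

For `I₁ = S₁` (`setI_eq_setS`), a measure `ν ≤ μ` is a density with values in `[0, 1]`. These
densities form a closed bounded convex set in the Hilbert space `L²(μ)`, and mass and first moment
are continuous linear functions of the density. Such a map has closed image on such a set, which is
weak compactness in the form of Cantor's intersection theorem. So `I₁` is closed and convex, and by
Hahn–Banach it is determined by its support function. That function is `σ`: among all `ν ≤ μ` of
mass `p`, a linear form has the largest integral when `ν` is `μ` restricted to the upper tail, and
absence of atoms gives that tail mass exactly `p`.

For Fréchet means, the bias-variance identity shows that the minimizer is the point which `Ψ` sends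
to the mean of `Ψ(Y₁)`. It exists because the range is closed and convex, so the identified sets
correspond under `Ψ⁻¹`. -/

noncomputable section

namespace LeeBounds

/-! ### Closed bounded convex sets in Hilbert space and their linear images. -/

open Filter Topology in
/-- Cantor's intersection theorem for closed bounded convex sets in a Hilbert space. -/
theorem nonempty_iInter_of_antitone_convex {E : Type*} [NormedAddCommGroup E]
    [InnerProductSpace ℝ E] [CompleteSpace E] {K : ℕ → Set E} (hanti : Antitone K)
    (hne : ∀ n, (K n).Nonempty) (hclosed : ∀ n, IsClosed (K n)) (hconv : ∀ n, Convex ℝ (K n))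
    (hbdd : Bornology.IsBounded (K 0)) : (⋂ n, K n).Nonempty := by
  have hmin : ∀ n, ∃ g ∈ K n, ∀ w ∈ K n, ‖g‖ ≤ ‖w‖ := by
    intro n
    obtain ⟨g, hg, h⟩ :=
      exists_norm_eq_iInf_of_complete_convex (hne n) (hclosed n).isComplete (hconv n) 0
    refine ⟨g, hg, fun w hw => ?_⟩
    have : ‖(0 : E) - g‖ ≤ ‖(0 : E) - w‖ := by
      rw [h]
      exact ciInf_le (f := fun w : K n => ‖(0 : E) - w‖)
        ⟨0, by rintro _ ⟨_, rfl⟩; positivity⟩ ⟨w, hw⟩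
    simpa using this
  choose g hgK hg using hmin
  obtain ⟨C, hC⟩ := hbdd.exists_norm_le
  have hmono : Monotone fun n => ‖g n‖ ^ 2 := fun n m hnm =>
    pow_le_pow_left₀ (norm_nonneg _) (hg n _ (hanti hnm (hgK m))) 2
  have hbound : BddAbove (range fun n => ‖g n‖ ^ 2) := by
    refine ⟨C ^ 2, ?_⟩
    rintro _ ⟨n, rfl⟩
    exact pow_le_pow_left₀ (norm_nonneg _) (hC _ (hanti (Nat.zero_le n) (hgK n))) 2
  have hlim := tendsto_atTop_ciSup hmono hbound
  set L := ⨆ n, ‖g n‖ ^ 2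
  -- The midpoint of `g n` and `g m` lies in `K n`, so its norm is at least `‖g n‖`; the
  -- parallelogram law then bounds the squared distance by `2 (‖g m‖² - ‖g n‖²)`.
  have hdist : ∀ n m, n ≤ m → dist (g n) (g m) ≤ √(2 * (L - ‖g n‖ ^ 2)) := by
    intro n m hnm
    apply Real.le_sqrt_of_sq_le
    have hmid : ‖g n‖ ≤ ‖(1 / 2 : ℝ) • (g n + g m)‖ := by
      apply hg n
      rw [smul_add]
      exact hconv n (hgK n) (hanti hnm (hgK m)) (by norm_num) (by norm_num) (by norm_num)
    rw [norm_smul] at hmid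
    norm_num at hmid
    have hpar := parallelogram_law_with_norm ℝ (g n) (g m)
    have hL : ‖g m‖ ^ 2 ≤ L := le_ciSup hbound m
    have hsq : (2 * ‖g n‖) ^ 2 ≤ ‖g n + g m‖ ^ 2 :=
      pow_le_pow_left₀ (by positivity) (by linarith) 2
    rw [dist_eq_norm]
    nlinarith
  have hb : Tendsto (fun n => √(2 * (L - ‖g n‖ ^ 2))) atTop (𝓝 0) := by
    have := ((tendsto_const_nhds (x := L)).sub hlim).const_mul 2
    simpa using this.sqrt
  obtain ⟨x, hx⟩ := cauchySeq_tendsto_of_complete (cauchySeq_of_le_tendsto_0' _ hdist hb)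
  refine ⟨x, mem_iInter.2 fun n => (hclosed n).mem_of_tendsto hx ?_⟩
  filter_upwards [eventually_ge_atTop n] with m hm using hanti hm (hgK m)

/-- The image of a closed bounded convex subset of a Hilbert space under a continuous linear map
is closed. -/
theorem isClosed_image_of_convex_of_isBounded {E F : Type*} [NormedAddCommGroup E]
    [InnerProductSpace ℝ E] [CompleteSpace E] [NormedAddCommGroup F] [NormedSpace ℝ F]
    (T : E →L[ℝ] F) {K : Set E} (hclosed : IsClosed K) (hconv : Convex ℝ K)
    (hbdd : Bornology.IsBounded K) : IsClosed (T '' K) := by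
  refine isClosed_of_closure_subset fun v hv => ?_
  -- Approximate fibres over `v`: a point common to all of them is mapped exactly to `v`.
  let A : ℕ → Set E := fun n => K ∩ T ⁻¹' Metric.closedBall v (1 / (n + 1))
  have hA : (⋂ n, A n).Nonempty := by
    refine nonempty_iInter_of_antitone_convex (fun n m hnm => ?_) (fun n => ?_)
      (fun n => hclosed.inter (Metric.isClosed_closedBall.preimage T.continuous))
      (fun n => hconv.inter ((convex_closedBall _ _).linear_preimage T.toLinearMap))
      (hbdd.subset inter_subset_left)
    · exact inter_subset_inter_right _
        (preimage_mono (Metric.closedBall_subset_closedBall (Nat.one_div_le_one_div hnm)))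
    · obtain ⟨_, ⟨x, hx, rfl⟩, h⟩ := Metric.mem_closure_iff.1 hv (1 / (n + 1)) (by positivity)
      exact ⟨x, hx, by rw [mem_preimage, Metric.mem_closedBall, dist_comm]; exact h.le⟩
  obtain ⟨x, hx⟩ := hA
  rw [mem_iInter] at hx
  refine ⟨x, (hx 0).1, dist_le_zero.1 ?_⟩
  exact ge_of_tendsto' tendsto_one_div_add_atTop_nhds_zero_nat fun n => (hx n).2

/-! ### The set `I₁` as a linear image of a set of densities. -/

section
variable {H : Type*} [NormedAddCommGroup H] [InnerProductSpace ℝ H] [CompleteSpace H]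
  [TopologicalSpace.SeparableSpace H] [MeasurableSpace H] [BorelSpace H]

omit [CompleteSpace H] [TopologicalSpace.SeparableSpace H] [BorelSpace H] in
theorem mem_setI_iff {μ : Measure H} {p : ℝ} {v : H} :
    v ∈ setI μ p ↔ ∃ ν : Measure H, ν ≤ μ ∧ ν univ = ENNReal.ofReal p ∧
      v = (1 / p) • ∫ x, x ∂ν := by
  simp only [setI, mem_ofPred_eq, Measure.le_iff]

omit [BorelSpace H] in
/-- Description of `I₁` by the densities of the measures `ν`. -/
theorem mem_setI_iff_exists_density {μ : Measure H} [IsProbabilityMeasure μ] {p : ℝ}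
    (hp : 0 < p) {v : H} :
    v ∈ setI μ p ↔ ∃ f : Lp ℝ 2 μ, (0 ≤ᵐ[μ] f ∧ f ≤ᵐ[μ] 1) ∧
      ∫ x, f x ∂μ = p ∧ ∫ x, f x • x ∂μ = p • v := by
  rw [mem_setI_iff]
  constructor
  · rintro ⟨ν, hν, hmass, rfl⟩
    have : IsFiniteMeasure ν := isFiniteMeasure_of_le μ hν
    have hac : ν ≪ μ := Measure.absolutelyContinuous_of_le hν
    have hle := Measure.rnDeriv_le_one_of_le hν
    have hle' : (fun x => (ν.rnDeriv μ x).toReal) ≤ᵐ[μ] 1 := by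
      filter_upwards [hle] with x hx
      simpa using ENNReal.toReal_mono ENNReal.one_ne_top hx
    -- A density bounded by 1 is square integrable, which places it in a Hilbert space.
    have hmem : MemLp (fun x => (ν.rnDeriv μ x).toReal) 2 μ := by
      refine MemLp.of_bound (ν.measurable_rnDeriv μ).ennreal_toReal.aestronglyMeasurable 1 ?_
      filter_upwards [hle'] with x hx
      rw [Real.norm_of_nonneg ENNReal.toReal_nonneg]
      exact hx
    have hf := hmem.coeFn_toLp
    refine ⟨hmem.toLp _, ⟨?_, hf.le.trans hle'⟩, ?_, ?_⟩
    · filter_upwards [hf] with x hx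
      rw [hx]
      exact ENNReal.toReal_nonneg
    · rw [integral_congr_ae hf, Measure.integral_toReal_rnDeriv hac, Measure.real, hmass,
        ENNReal.toReal_ofReal hp.le]
    · rw [smul_smul, mul_one_div_cancel hp.ne', one_smul, ← integral_rnDeriv_smul hac]
      refine integral_congr_ae ?_
      filter_upwards [hf] with x hx
      rw [hx]
  · rintro ⟨f, ⟨h0, h1⟩, hmass, hv⟩
    have hmeas : AEMeasurable f μ := (Lp.aestronglyMeasurable f).aemeasurable
    have hint : Integrable f μ := (Lp.memLp f).integrable (by norm_num)
    refine ⟨μ.withDensity fun x => ENNReal.ofReal (f x), ?_, ?_, ?_⟩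
    · calc μ.withDensity (fun x => ENNReal.ofReal (f x)) ≤ μ.withDensity 1 := by
            refine withDensity_mono ?_
            filter_upwards [h1] with x hx
            simpa using hx
        _ = μ := withDensity_one
    · rw [withDensity_apply _ MeasurableSet.univ, Measure.restrict_univ,
        ← ofReal_integral_eq_lintegral_ofReal hint h0, hmass]
    · rw [integral_withDensity_eq_integral_toReal_smul₀ hmeas.ennreal_ofReal (by simp)]
      have : ∫ x, (ENNReal.ofReal (f x)).toReal • x ∂μ = p • v := by
        rw [← hv]
        refine integral_congr_ae ?_
        filter_upwards [h0] with x hx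
        rw [ENNReal.toReal_ofReal hx]
      rw [this, smul_smul, one_div_mul_cancel hp.ne', one_smul]

-- Mass and first moment are continuous on `L²(μ)`, the latter because the identity is square
-- integrable. The pair sends the order interval `[0, 1]` to a closed convex set, of which `I₁` is a
-- rescaled slice.
omit [BorelSpace H] in
theorem convex_isClosed_setI {μ : Measure H} [IsProbabilityMeasure μ]
    (hμ : MemLp (fun x : H => x) 2 μ) {p : ℝ} (hp : 0 < p) :
    Convex ℝ (setI μ p) ∧ IsClosed (setI μ p) := by
  let c : Lp ℝ 2 μ := (memLp_const (1 : ℝ)).toLp _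
  let T : Lp ℝ 2 μ →L[ℝ] ℝ × H :=
    (((ContinuousLinearMap.lsmul ℝ ℝ).lpPairing μ 2 2).flip c).prod
      (((ContinuousLinearMap.lsmul ℝ ℝ).lpPairing μ 2 2).flip (hμ.toLp _))
  have hT : ∀ f, T f = (∫ x, f x ∂μ, ∫ x, f x • x ∂μ) := by
    intro f
    simp only [T, ContinuousLinearMap.prod_apply, ContinuousLinearMap.flip_apply,
      ContinuousLinearMap.lpPairing_eq_integral, ContinuousLinearMap.lsmul_apply]
    congr 1
    · refine integral_congr_ae ?_
      filter_upwards [(memLp_const (μ := μ) (p := 2) (1 : ℝ)).coeFn_toLp] with x hx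
      rw [hx, smul_eq_mul, mul_one]
    · refine integral_congr_ae ?_
      filter_upwards [hμ.coeFn_toLp] with x hx
      rw [hx]
  let K : Set (Lp ℝ 2 μ) := Icc 0 c
  have hK : ∀ f, f ∈ K ↔ 0 ≤ᵐ[μ] f ∧ f ≤ᵐ[μ] 1 := by
    intro f
    have hc : c =ᵐ[μ] 1 := (memLp_const (μ := μ) (p := 2) (1 : ℝ)).coeFn_toLp
    rw [mem_Icc, ← Lp.coeFn_nonneg, ← Lp.coeFn_le]
    refine and_congr_right fun _ => ⟨fun h => h.trans hc.le, fun h => h.trans hc.symm.le⟩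
  have hKconv : Convex ℝ K := by
    intro f hf g hg a b ha hb hab
    rw [hK] at hf hg ⊢
    have hco := Lp.coeFn_add (a • f) (b • g)
    constructor
    · filter_upwards [hf.1, hg.1, hco, Lp.coeFn_smul a f, Lp.coeFn_smul b g] with x h1 h2 h h3 h4
      rw [h, Pi.add_apply, h3, h4]
      simp only [Pi.smul_apply, smul_eq_mul, Pi.zero_apply] at *
      positivity
    · filter_upwards [hf.2, hg.2, hco, Lp.coeFn_smul a f, Lp.coeFn_smul b g] with x h1 h2 h h3 h4
      rw [h, Pi.add_apply, h3, h4]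
      simp only [Pi.smul_apply, smul_eq_mul, Pi.one_apply] at *
      nlinarith
  have hKbdd : Bornology.IsBounded K := by
    refine isBounded_iff_forall_norm_le.2 ⟨‖c‖, fun f hf => ?_⟩
    exact norm_le_norm_of_abs_le_abs (by
      rw [abs_of_nonneg hf.1, abs_of_nonneg (hf.1.trans hf.2)]; exact hf.2)
  -- The first coordinate imposes the mass constraint, and the second undoes the factor `1 / p`.
  have himage : setI μ p = (fun v : H => (p, p • v)) ⁻¹' (T '' K) := by
    ext v
    rw [mem_setI_iff_exists_density hp]
    simp only [mem_preimage, mem_image, hK, hT, Prod.mk.injEq]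
  constructor
  · intro v hv w hw a b ha hb hab
    rw [himage, mem_preimage] at hv hw ⊢
    have hcomb : (p, p • (a • v + b • w)) = a • (p, p • v) + b • (p, p • w) := by
      simp only [smul_add, Prod.smul_mk, Prod.mk_add_mk, smul_comm p]
      rw [← add_smul, hab, one_smul]
    rw [hcomb]
    exact (hKconv.linear_image T.toLinearMap) hv hw ha hb hab
  · rw [himage]
    exact (isClosed_image_of_convex_of_isBounded T isClosed_Icc hKconv hKbdd).preimage
      (by fun_prop)
end

/-! ### Quantiles of laws without atoms. -/

open Filter Topology in
theorem continuous_cdf (ρ : Measure ℝ) [IsProbabilityMeasure ρ] [NullSingletonClass ρ] :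
    Continuous (cdf ρ) := by
  refine continuous_iff_continuousAt.2 fun x => ?_
  rw [(cdf ρ).mono.continuousAt_iff_leftLim_eq_rightLim, (cdf ρ).rightLim_eq]
  refine le_antisymm ((cdf ρ).mono.leftLim_le le_rfl) ?_
  have := (cdf ρ).measure_singleton x
  rw [measure_cdf, measure_singleton] at this
  linarith [ENNReal.ofReal_eq_zero.1 this.symm]

theorem quantile_zero (ρ : Measure ℝ) : quantile ρ 0 = ⊥ := by
  rw [quantile, sInf_eq_bot]
  intro b hb
  obtain ⟨t, _, ht⟩ := EReal.lt_iff_exists_real_btwn.1 hb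
  exact ⟨t, ⟨t, measureReal_nonneg, rfl⟩, ht⟩

/-- At a level in `(0, 1)`, the quantile of a law without atoms is a real number at which the
distribution function takes that level. -/
theorem exists_quantile_eq (ρ : Measure ℝ) [IsProbabilityMeasure ρ] [NullSingletonClass ρ] {r : ℝ}
    (h0 : 0 < r) (h1 : r < 1) : ∃ q : ℝ, quantile ρ r = q ∧ ρ.real (Iic q) = r := by
  have hc := continuous_cdf ρ
  obtain ⟨t, ht⟩ : ∃ t, cdf ρ t = r := by
    refine mem_range_of_exists_le_of_exists_ge hc ?_ ?_
    · exact ((tendsto_cdf_atBot ρ).eventually_le_const h0).exists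
    · exact ((tendsto_cdf_atTop ρ).eventually_const_le h1).exists
  -- Continuity makes this set closed, so its infimum belongs to it and is the quantile; comparison
  -- with the `t` found above excludes overshooting the level.
  let T : Set ℝ := {t | r ≤ cdf ρ t}
  have hT : IsClosed T := isClosed_le continuous_const hc
  have hbdd : BddBelow T := by
    obtain ⟨s, hs⟩ := ((tendsto_cdf_atBot ρ).eventually_lt_const h0).exists
    exact ⟨s, fun x hx => le_of_lt ((cdf ρ).mono.reflect_lt (hs.trans_le hx))⟩
  have hmem : sInf T ∈ T := hT.csInf_mem ⟨t, ht.ge⟩ hbdd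
  refine ⟨sInf T, ?_, le_antisymm ?_ ?_⟩
  · have hleast : IsLeast T (sInf T) := ⟨hmem, fun x hx => csInf_le hbdd hx⟩
    have : T = {t : ℝ | r ≤ ρ.real (Iic t)} := by
      ext t
      simp only [T, mem_ofPred_eq, cdf_eq_real]
    rw [quantile, ← this]
    exact (EReal.coe_strictMono.monotone.map_isLeast hleast).csInf_eq
  · rw [← cdf_eq_real, ← ht]
    exact (cdf ρ).mono (csInf_le hbdd ht.ge)
  · rw [← cdf_eq_real]
    exact hmem

/-! ### The support function of `I₁` and the equality with `S₁`. -/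

section
variable {H : Type*} [NormedAddCommGroup H] [InnerProductSpace ℝ H] [CompleteSpace H]
  [TopologicalSpace.SeparableSpace H] [MeasurableSpace H] [BorelSpace H]

/-- The event `⟨u, X⟩ ≥ Q(1 - p)` is measurable of probability `p`, and it is either everything
or a half-space. -/
theorem trimmedEvent_spec {μ : Measure H} [IsProbabilityMeasure μ] {p : ℝ} (hp0 : 0 < p)
    (hp1 : p ≤ 1) {u : H} (hcont : ∀ c : ℝ, μ {x | inner ℝ u x = c} = 0) :
    ∃ A : Set H, A = {x | quantile (μ.map (fun x => inner ℝ u x)) (1 - p) ≤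
        ((inner ℝ u x : ℝ) : EReal)} ∧ MeasurableSet A ∧ μ A = ENNReal.ofReal p ∧
      (A = univ ∨ ∃ q : ℝ, A = {x | q ≤ inner ℝ u x}) := by
  have hm : Measurable fun x : H => (inner ℝ u x : ℝ) := by fun_prop
  refine ⟨_, rfl, ?_⟩
  -- For `p = 1` the quantile is `⊥` and nothing is trimmed, so no real threshold need exist.
  rcases hp1.eq_or_lt with rfl | hp1
  · have : {x : H | quantile (μ.map (fun x => inner ℝ u x)) (1 - 1) ≤
        ((inner ℝ u x : ℝ) : EReal)} = univ := by
      simp [quantile_zero]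
    rw [this]
    simp
  · have : IsProbabilityMeasure (μ.map (fun x => (inner ℝ u x : ℝ))) :=
      Measure.isProbabilityMeasure_map hm.aemeasurable
    have : NullSingletonClass (μ.map (fun x => (inner ℝ u x : ℝ))) := ⟨fun c => by
      rw [Measure.map_apply hm (measurableSet_singleton c)]
      exact hcont c⟩
    obtain ⟨q, hq, hF⟩ := exists_quantile_eq (μ.map (fun x => (inner ℝ u x : ℝ)))
      (r := 1 - p) (by linarith) (by linarith)
    have hA : {x : H | quantile (μ.map (fun x => inner ℝ u x)) (1 - p) ≤
        ((inner ℝ u x : ℝ) : EReal)} = {x | q ≤ inner ℝ u x} := by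
      rw [hq]
      simp only [EReal.coe_le_coe_iff]
    rw [hA]
    refine ⟨measurableSet_le measurable_const hm, ?_, Or.inr ⟨q, rfl⟩⟩
    have h1 : μ {x : H | q ≤ inner ℝ u x} = (μ.map (fun x => (inner ℝ u x : ℝ))) (Ici q) :=
      (Measure.map_apply hm measurableSet_Ici).symm
    rw [h1, ← measure_congr Ioi_ae_eq_Ici, ← compl_Iic, prob_compl_eq_one_sub measurableSet_Iic,
      ← ofReal_measureReal, hF, ← ENNReal.ofReal_one, ← ENNReal.ofReal_sub _ (by linarith)]
    congr 1
    ring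

omit [CompleteSpace H] [TopologicalSpace.SeparableSpace H] [BorelSpace H] in
theorem trimmedMean_eq {μ : Measure H} {p : ℝ}
    (hp0 : 0 < p) {u : H} {A : Set H}
    (hA : A = {x | quantile (μ.map (fun x => inner ℝ u x)) (1 - p) ≤
        ((inner ℝ u x : ℝ) : EReal)}) (hμA : μ A = ENNReal.ofReal p) :
    trimmedMean μ p u = (1 / p) * ∫ x in A, inner ℝ u x ∂μ := by
  rw [trimmedMean, ← hA, ProbabilityTheory.cond, integral_smul_measure, hμA, ENNReal.toReal_inv,
    ENNReal.toReal_ofReal hp0.le, smul_eq_mul, one_div]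

/-- Among the measures `ν ≤ μ` of a given mass, the restriction of `μ` to an upper half-space
maximizes the integral of the linear form. -/
theorem integral_le_setIntegral_of_le {α : Type*} [MeasurableSpace α] {μ ν : Measure α}
    [IsFiniteMeasure μ] (hν : ν ≤ μ) {g : α → ℝ} (hg : Integrable g μ) {A : Set α}
    (hA : MeasurableSet A) (hmass : ν univ = μ A)
    (hform : A = univ ∨ ∃ q : ℝ, A = {x | q ≤ g x}) :
    ∫ x, g x ∂ν ≤ ∫ x in A, g x ∂μ := by
  have : IsFiniteMeasure ν := isFiniteMeasure_of_le μ hν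
  rcases hform with rfl | ⟨q, hq⟩
  · rw [Measure.eq_of_le_of_measure_univ_eq hν hmass, Measure.restrict_univ]
  · have hgν : Integrable g ν := hg.mono_measure hν
    have hi : ∀ ξ : Measure α, [IsFiniteMeasure ξ] → Integrable g ξ →
        Integrable (fun x => g x - q) ξ := fun ξ _ h => h.sub (integrable_const q)
    -- After centring at the threshold, `g - q` is negative off `A` and nonnegative on `A`: dropping
    -- the complement and then enlarging `ν` to `μ` on `A` both increase the integral. The terms in
    -- `q` cancel because the masses agree.
    have h1 : ∫ x, (g x - q) ∂ν ≤ ∫ x in A, (g x - q) ∂ν := by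
      rw [← integral_add_compl hA (hi ν hgν)]
      have : ∫ x in Aᶜ, (g x - q) ∂ν ≤ 0 := by
        refine setIntegral_nonpos hA.compl fun x hx => ?_
        rw [hq] at hx
        have : g x < q := not_le.1 hx
        linarith
      linarith
    have h2 : ∫ x in A, (g x - q) ∂ν ≤ ∫ x in A, (g x - q) ∂μ := by
      refine integral_mono_measure (Measure.restrict_mono_measure hν A) ?_
        (hi μ hg).integrableOn
      refine (ae_restrict_iff' hA).2 (Filter.Eventually.of_forall fun x hx => ?_)
      rw [hq] at hx
      exact sub_nonneg.2 hx
    rw [integral_sub hgν (integrable_const q)] at h1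
    rw [integral_sub (hg.restrict (s := A)) (integrable_const q)] at h2
    simp only [integral_const, smul_eq_mul, Measure.real, Measure.restrict_apply_univ, hmass]
      at h1 h2
    linarith

/-- `σ` is the support function of `I₁`. -/
theorem isGreatest_trimmedMean {μ : Measure H} [IsProbabilityMeasure μ]
    (hint : Integrable (fun x : H => x) μ) {p : ℝ} (hp0 : 0 < p)
    (hp1 : p ≤ 1) {u : H} (hcont : ∀ c : ℝ, μ {x | inner ℝ u x = c} = 0) :
    IsGreatest ((fun v => inner ℝ u v) '' setI μ p) (trimmedMean μ p u) := by
  obtain ⟨A, hA, hmeas, hμA, hform⟩ := trimmedEvent_spec hp0 hp1 hcont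
  have hval : ∀ ν : Measure H, ν ≤ μ →
      inner ℝ u ((1 / p) • ∫ x, x ∂ν) = (1 / p) * ∫ x, inner ℝ u x ∂ν := by
    intro ν hν
    rw [inner_smul_right, integral_inner (hint.mono_measure hν)]
  rw [trimmedMean_eq hp0 hA hμA]
  constructor
  · refine ⟨(1 / p) • ∫ x in A, x ∂μ, ?_, hval _ Measure.restrict_le_self⟩
    exact mem_setI_iff.2 ⟨_, Measure.restrict_le_self, by rw [Measure.restrict_apply_univ, hμA], rfl⟩
  · rintro _ ⟨_, hv, rfl⟩
    obtain ⟨ν, hν, hmass, rfl⟩ := mem_setI_iff.1 hv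
    simp only [hval ν hν]
    refine mul_le_mul_of_nonneg_left ?_ (by positivity)
    exact integral_le_setIntegral_of_le hν (hint.const_inner u) hmeas (hmass.trans hμA.symm) hform

omit [CompleteSpace H] [TopologicalSpace.SeparableSpace H] [BorelSpace H] in
theorem setI_nonempty {μ : Measure H} [IsProbabilityMeasure μ] {p : ℝ} (hp1 : p ≤ 1) :
    (setI μ p).Nonempty := by
  refine ⟨_, mem_setI_iff.2 ⟨ENNReal.ofReal p • μ, ?_, by simp, rfl⟩⟩
  intro A
  simpa using mul_le_of_le_one_left (zero_le (a := μ A)) (ENNReal.ofReal_le_one.2 hp1)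

/-- The set `I₁` is closed and convex, hence the intersection of its supporting half-spaces. -/
theorem setI_eq_setS {μ : Measure H} [IsProbabilityMeasure μ]
    (hμ : MemLp (fun x : H => x) 2 μ) {p : ℝ} (hp0 : 0 < p) (hp1 : p ≤ 1)
    (hcont : ∀ u : H, ‖u‖ = 1 → ∀ c : ℝ, μ {x | inner ℝ u x = c} = 0) :
    setI μ p = setS μ p := by
  have hint : Integrable (fun x : H => x) μ := hμ.integrable (by norm_num)
  obtain ⟨hconv, hclosed⟩ := convex_isClosed_setI hμ hp0
  refine Subset.antisymm (fun v hv => ?_) (fun v hv => ?_)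
  · refine mem_iInter₂.2 fun u hu => ?_
    exact (isGreatest_trimmedMean hint hp0 hp1 (hcont u hu)).2 ⟨v, hv, rfl⟩
  · by_contra hvI
    obtain ⟨f, c, hfc, hcv⟩ := geometric_hahn_banach_closed_point hconv hclosed hvI
    obtain ⟨w, rfl⟩ := (InnerProductSpace.toDual ℝ H).surjective f
    simp only [InnerProductSpace.toDual_apply_apply] at hfc hcv
    -- The zero form cannot separate `v` from a nonempty set; hence `w` can be normalized to a unit
    -- direction, as `σ` requires.
    have hw : w ≠ 0 := by
      rintro rfl
      obtain ⟨a, ha⟩ := setI_nonempty (μ := μ) hp1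
      have := hfc a ha
      simp only [inner_zero_left] at this hcv
      linarith
    have hw' : 0 < ‖w‖ := norm_pos_iff.2 hw
    have hu : ‖‖w‖⁻¹ • w‖ = 1 := norm_smul_inv_norm (𝕜 := ℝ) hw
    obtain ⟨a, ha, hmax⟩ := (isGreatest_trimmedMean hint hp0 hp1 (hcont _ hu)).1
    have hva : inner ℝ (‖w‖⁻¹ • w) v ≤ trimmedMean μ p (‖w‖⁻¹ • w) := mem_iInter₂.1 hv _ hu
    rw [← hmax] at hva
    simp only [real_inner_smul_left] at hva
    have := le_of_mul_le_mul_left hva (by positivity)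
    linarith [hfc a ha]
end

/-! ### The selection model: latent laws and the observed laws they induce. -/

section
variable {𝒴 : Type*} [MeasurableSpace 𝒴]

theorem measurable_selected {α : Type*} [MeasurableSpace α] {s : α → Bool} {y : α → 𝒴}
    (hs : Measurable s) (hy : Measurable y) :
    Measurable fun a => (s a, if s a then Sum.inl (y a) else (Sum.inr () : 𝒴 ⊕ Unit)) :=
  hs.prodMk (Measurable.ite (hs (measurableSet_singleton true)) (measurable_inl.comp hy)
    measurable_const)

theorem measurable_observe : Measurable (observe : Latent 𝒴 → Observed 𝒴) := by
  have hd : MeasurableSet {x : Latent 𝒴 | x.1 = true} :=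
    measurable_fst (measurableSet_singleton true)
  have hs : Measurable fun x : Latent 𝒴 => if x.1 then x.2.2.2.1 else x.2.2.2.2 :=
    Measurable.ite hd (by fun_prop) (by fun_prop)
  have hy : Measurable fun x : Latent 𝒴 => if x.1 then x.2.1 else x.2.2.1 :=
    Measurable.ite hd (by fun_prop) (by fun_prop)
  exact measurable_fst.prodMk (measurable_selected hs hy)

theorem measurableSet_bool_eq {α : Type*} [MeasurableSpace α] {s : α → Bool} (hs : Measurable s)
    (b : Bool) : MeasurableSet {a | s a = b} :=
  hs (measurableSet_singleton b)

theorem measurableSet_monotone :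
    MeasurableSet {l : 𝒴 × 𝒴 × Bool × Bool | l.2.2.2 ≤ l.2.2.1} :=
  (measurable_snd.comp measurable_snd)
    (MeasurableSet.of_discrete (s := {b : Bool × Bool | b.2 ≤ b.1}))

/-- The model consists of the products of a law of the treatment and a law of the potential
variables which satisfies monotonicity. -/
theorem mem_selectionModel_iff {γ : Measure (Latent 𝒴)} :
    γ ∈ selectionModel 𝒴 ↔ ∃ (δ : Measure Bool) (κ : Measure (𝒴 × 𝒴 × Bool × Bool)),
      IsProbabilityMeasure δ ∧ IsProbabilityMeasure κ ∧ γ = δ.prod κ ∧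
      ∀ᵐ l ∂κ, l.2.2.2 ≤ l.2.2.1 := by
  constructor
  · rintro ⟨hγ, hind, hmono⟩
    refine ⟨γ.map Prod.fst, γ.map Prod.snd,
      Measure.isProbabilityMeasure_map measurable_fst.aemeasurable,
      Measure.isProbabilityMeasure_map measurable_snd.aemeasurable, ?_, ?_⟩
    · rw [indepFun_iff_map_prod_eq_prod_map_map measurable_fst.aemeasurable
        measurable_snd.aemeasurable] at hind
      rw [← hind]
      exact Measure.map_id.symm
    · exact (ae_map_iff measurable_snd.aemeasurable measurableSet_monotone).2 hmono
  · rintro ⟨δ, κ, hδ, hκ, rfl, hmono⟩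
    refine ⟨inferInstance, indepFun_prod measurable_id measurable_id, ?_⟩
    exact (Measure.quasiMeasurePreserving_snd (μ := δ) (ν := κ)).ae hmono

/-- Unselected units all yield the single value `(false, NA)`, so they contribute only their total
mass, which is one minus the selected mass. -/
theorem measure_selected_congr {α : Type*} [MeasurableSpace α] {κ κ' : Measure α}
    [IsProbabilityMeasure κ] [IsProbabilityMeasure κ'] {s : α → Bool} {y : α → 𝒴}
    (hs : Measurable s) (h : ∀ B, MeasurableSet B →
      κ {a | y a ∈ B ∧ s a = true} = κ' {a | y a ∈ B ∧ s a = true})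
    {C : Set (Bool × (𝒴 ⊕ Unit))} (hC : MeasurableSet C) :
    κ {a | (s a, if s a then Sum.inl (y a) else (Sum.inr () : 𝒴 ⊕ Unit)) ∈ C} =
      κ' {a | (s a, if s a then Sum.inl (y a) else (Sum.inr () : 𝒴 ⊕ Unit)) ∈ C} := by
  have hS := measurableSet_bool_eq hs true
  rw [← measure_inter_add_sdiff _ hS, ← measure_inter_add_sdiff (μ := κ') _ hS]
  congr 1
  · have : {a | (s a, if s a then Sum.inl (y a) else (Sum.inr () : 𝒴 ⊕ Unit)) ∈ C} ∩
        {a | s a = true} = {a | y a ∈ {z | (true, Sum.inl z) ∈ C} ∧ s a = true} := by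
      ext a
      simp +contextual only [mem_inter_iff, mem_ofPred_eq, if_true, and_congr_left_iff,
        implies_true]
    rw [this]
    exact h _ ((measurable_const.prodMk measurable_inl) hC)
  · have hdiff : {a | (s a, if s a then Sum.inl (y a) else (Sum.inr () : 𝒴 ⊕ Unit)) ∈ C} \
        {a | s a = true} = {a | ((false, Sum.inr ()) : Bool × (𝒴 ⊕ Unit)) ∈ C} \
          {a | s a = true} := by
      ext a
      cases hsa : s a <;> simp [hsa]
    rw [hdiff]
    by_cases hmem : ((false, Sum.inr ()) : Bool × (𝒴 ⊕ Unit)) ∈ C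
    · simp only [hmem, ofPred_true, ← compl_eq_univ_sdiff]
      rw [prob_compl_eq_one_sub hS, prob_compl_eq_one_sub hS]
      simpa using congrArg (fun t => 1 - t) (h univ MeasurableSet.univ)
    · simp [hmem]

/-- The law of the observed data depends on the law of the potential variables only through the
laws of the selected outcomes in the two treatment arms. -/
theorem observedLaw_prod_congr (δ : Measure Bool) [IsProbabilityMeasure δ]
    {κ κ' : Measure (𝒴 × 𝒴 × Bool × Bool)} [IsProbabilityMeasure κ] [IsProbabilityMeasure κ']
    (h1 : ∀ B, MeasurableSet B →
      κ {l | l.1 ∈ B ∧ l.2.2.1 = true} = κ' {l | l.1 ∈ B ∧ l.2.2.1 = true})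
    (h0 : ∀ B, MeasurableSet B →
      κ {l | l.2.1 ∈ B ∧ l.2.2.2 = true} = κ' {l | l.2.1 ∈ B ∧ l.2.2.2 = true}) :
    observedLaw (δ.prod κ) = observedLaw (δ.prod κ') := by
  ext C hC
  rw [observedLaw, observedLaw, Measure.map_apply measurable_observe hC,
    Measure.map_apply measurable_observe hC, Measure.prod_apply (measurable_observe hC),
    Measure.prod_apply (measurable_observe hC)]
  refine lintegral_congr fun d => ?_
  cases d
  · exact measure_selected_congr (y := fun l : 𝒴 × 𝒴 × Bool × Bool => l.2.1)
      (s := fun l => l.2.2.2) (by fun_prop) h0 (measurable_prodMk_left (x := false) hC)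
  · exact measure_selected_congr (y := fun l : 𝒴 × 𝒴 × Bool × Bool => l.1)
      (s := fun l => l.2.2.1) (by fun_prop) h1 (measurable_prodMk_left (x := true) hC)

section
variable (δ : Measure Bool) (κ : Measure (𝒴 × 𝒴 × Bool × Bool))
  [IsProbabilityMeasure κ]

theorem observedLaw_prod_apply {C : Set (Observed 𝒴)} (hC : MeasurableSet C) {d : Bool}
    {T : Set (𝒴 × 𝒴 × Bool × Bool)}
    (hT : ∀ x : Latent 𝒴, observe x ∈ C ↔ x.1 = d ∧ x.2 ∈ T) :
    observedLaw (δ.prod κ) C = δ {d} * κ T := by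
  have : observe ⁻¹' C = {d} ×ˢ T := by
    ext x
    rw [mem_preimage, hT, mem_prod, mem_singleton_iff]
  rw [observedLaw, Measure.map_apply measurable_observe hC, this, Measure.prod_prod]

omit [MeasurableSpace 𝒴] in
theorem observe_mem_treated_iff (x : Latent 𝒴) (A : Set (𝒴 ⊕ Unit)) :
    ((observe x).1 = true ∧ (observe x).2.1 = true) ∧ (observe x).2.2 ∈ A ↔
      x.1 = true ∧ Sum.inl x.2.1 ∈ A ∧ x.2.2.2.1 = true := by
  rcases x with ⟨d, y₁, y₀, s₁, s₀⟩
  cases d <;> cases s₁ <;> simp [observe]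

theorem measurableSet_observed (d : Bool) : MeasurableSet {o : Observed 𝒴 | o.1 = d} :=
  measurableSet_bool_eq measurable_fst d

theorem measurableSet_observed_selected (d : Bool) :
    MeasurableSet {o : Observed 𝒴 | o.1 = d ∧ o.2.1 = true} :=
  (measurableSet_observed d).inter (measurableSet_bool_eq (by fun_prop) true)

theorem observedLaw_prod_arm (d : Bool) :
    observedLaw (δ.prod κ) {o | o.1 = d} = δ {d} := by
  rw [observedLaw_prod_apply δ κ (measurableSet_observed d) (T := univ) (d := d), measure_univ,
    mul_one]
  rintro ⟨d, y₁, y₀, s₁, s₀⟩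
  simp [observe]

theorem observedLaw_prod_control :
    observedLaw (δ.prod κ) {o | o.1 = false ∧ o.2.1 = true} =
      δ {false} * κ {l | l.2.2.2 = true} := by
  refine observedLaw_prod_apply δ κ (measurableSet_observed_selected false) ?_
  rintro ⟨d, y₁, y₀, s₁, s₀⟩
  cases d <;> simp [observe]

theorem observedLaw_prod_treated :
    observedLaw (δ.prod κ) {o | o.1 = true ∧ o.2.1 = true} =
      δ {true} * κ {l | l.2.2.1 = true} := by
  refine observedLaw_prod_apply δ κ (measurableSet_observed_selected true) ?_
  rintro ⟨d, y₁, y₀, s₁, s₀⟩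
  cases d <;> simp [observe]

variable [IsProbabilityMeasure δ]

/-- By independence, conditioning on an arm cancels the probability of that arm. -/
theorem trimming_observedLaw_prod (ht : δ {true} ≠ 0) (hf : δ {false} ≠ 0) :
    trimming (observedLaw (δ.prod κ)) =
      κ.real {l | l.2.2.2 = true} / κ.real {l | l.2.2.1 = true} := by
  have hcancel : ∀ d, δ {d} ≠ 0 → ∀ t : ℝ≥0∞, (δ {d})⁻¹ * (δ {d} * t) = t := fun d hd t => by
    rw [← mul_assoc, ENNReal.inv_mul_cancel hd (measure_ne_top _ _), one_mul]
  have h0 := observedLaw_prod_control δ κ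
  have h1 := observedLaw_prod_treated δ κ
  rw [trimming, Measure.real, Measure.real, cond_apply (measurableSet_observed false),
    cond_apply (measurableSet_observed true), observedLaw_prod_arm, observedLaw_prod_arm]
  change ((δ {false})⁻¹ * observedLaw (δ.prod κ) {o | o.1 = false ∧ o.2.1 = true}).toReal /
    ((δ {true})⁻¹ * observedLaw (δ.prod κ) {o | o.1 = true ∧ o.2.1 = true}).toReal = _
  rw [h0, h1, hcancel _ ht, hcancel _ hf]
  rfl

theorem embeddedLaw_observedLaw_prod {H : Type*} [NormedAddCommGroup H] [MeasurableSpace H]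
    {Ψ : 𝒴 → H} (hΨ : Measurable Ψ) (ht : δ {true} ≠ 0) :
    embeddedLaw Ψ (observedLaw (δ.prod κ)) =
      ((κ[|{l | l.2.2.1 = true}]).map fun l => l.1).map Ψ := by
  have hemb : Measurable (embedObserved Ψ) := hΨ.sumElim measurable_const
  ext A hA
  rw [embeddedLaw, Measure.map_apply (by fun_prop) hA, Measure.map_apply hΨ hA,
    Measure.map_apply measurable_fst (hΨ hA), cond_apply (measurableSet_observed_selected true),
    cond_apply (measurableSet_bool_eq (by fun_prop) true), observedLaw_prod_treated,
    observedLaw_prod_apply δ κ (d := true)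
      (T := {l | l.2.2.1 = true} ∩ (fun l => l.1) ⁻¹' (Ψ ⁻¹' A)),
    ENNReal.mul_inv (Or.inl ht) (Or.inl (measure_ne_top _ _)), mul_mul_mul_comm,
    ENNReal.inv_mul_cancel ht (measure_ne_top _ _), one_mul]
  · exact (measurableSet_observed_selected true).inter ((hemb.comp (by fun_prop)) hA)
  · intro x
    refine (observe_mem_treated_iff x (embedObserved Ψ ⁻¹' A)).trans (and_congr_right fun _ => ?_)
    exact and_comm

/-- The always-selected event has mass `κ {S₁ = 1} * p`; conditioning on it cancels the first factor
and leaves `N / p`. Shared by both directions of the characterization. -/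
theorem alwaysObservedLaw_prod {N : Measure 𝒴} {p : ℝ}
    (hN : ∀ B, MeasurableSet B → κ {l | l.1 ∈ B ∧ l.2.2.1 = true ∧ l.2.2.2 = true} =
      κ {l | l.2.2.1 = true} * N B) (hmass : N univ = ENNReal.ofReal p)
    (hsel : κ {l | l.2.2.1 = true} ≠ 0) :
    alwaysObservedLaw (δ.prod κ) = (ENNReal.ofReal p)⁻¹ • N := by
  have hboth : MeasurableSet {x : Latent 𝒴 | x.2.2.2.1 = true ∧ x.2.2.2.2 = true} :=
    (measurableSet_bool_eq (by fun_prop) true).inter (measurableSet_bool_eq (by fun_prop) true)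
  have hprod : ∀ T : Set (𝒴 × 𝒴 × Bool × Bool), (δ.prod κ) {x | x.2 ∈ T} = κ T := by
    intro T
    have : {x : Latent 𝒴 | x.2 ∈ T} = univ ×ˢ T := by
      ext x
      simp
    rw [this, Measure.prod_prod, measure_univ, one_mul]
  have huniv := hN univ MeasurableSet.univ
  simp only [mem_univ, true_and] at huniv
  ext B hB
  rw [alwaysObservedLaw, Measure.map_apply (by fun_prop) hB, cond_apply hboth]
  have h1 := hprod {l | l.2.2.1 = true ∧ l.2.2.2 = true}
  have h2 := hprod {l | l.1 ∈ B ∧ l.2.2.1 = true ∧ l.2.2.2 = true}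
  have hinter : {x : Latent 𝒴 | x.2.2.2.1 = true ∧ x.2.2.2.2 = true} ∩
      (fun x => x.2.1) ⁻¹' B =
      {x | x.2 ∈ {l | l.1 ∈ B ∧ l.2.2.1 = true ∧ l.2.2.2 = true}} := by
    ext x
    exact and_comm
  rw [hinter, h2, hN B hB]
  change ((δ.prod κ) {x | x.2 ∈ {l | l.2.2.1 = true ∧ l.2.2.2 = true}})⁻¹ * _ = _
  rw [h1, huniv, hmass, ENNReal.mul_inv (Or.inl hsel) (Or.inl (measure_ne_top _ _)),
    mul_mul_mul_comm, ENNReal.inv_mul_cancel hsel (measure_ne_top _ _), one_mul,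
    Measure.smul_apply, smul_eq_mul]

end

theorem measure_control_le_treated {κ : Measure (𝒴 × 𝒴 × Bool × Bool)}
    (hmono : ∀ᵐ l ∂κ, l.2.2.2 ≤ l.2.2.1) :
    κ {l | l.2.2.2 = true} ≤ κ {l | l.2.2.1 = true} := by
  refine measure_mono_ae ?_
  filter_upwards [hmono] with l hl h using Bool.le_iff_imp.1 hl h

/-- The conditional law of the treated outcome of the always-observed has a density of at most
`1 / p`. -/
theorem exists_le_of_latentLaw (δ : Measure Bool) [IsProbabilityMeasure δ]
    {κ : Measure (𝒴 × 𝒴 × Bool × Bool)} [IsProbabilityMeasure κ]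
    (hmono : ∀ᵐ l ∂κ, l.2.2.2 ≤ l.2.2.1) {p : ℝ} (hsel : κ {l | l.2.2.1 = true} ≠ 0)
    (hp : κ {l | l.2.2.1 = true} * ENNReal.ofReal p = κ {l | l.2.2.2 = true}) :
    ∃ N ≤ (κ[|{l | l.2.2.1 = true}]).map (fun l => l.1), N univ = ENNReal.ofReal p ∧
      alwaysObservedLaw (δ.prod κ) = (ENNReal.ofReal p)⁻¹ • N := by
  have htop : κ {l | l.2.2.1 = true} ≠ ∞ := measure_ne_top _ _
  -- Always-selected outcomes, normalized by the mass of `S₁ = 1`, so that domination by the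
  -- conditional law given `S₁ = 1` is plain inclusion of events.
  let N := (κ {l | l.2.2.1 = true})⁻¹ •
    (κ.restrict {l | l.2.2.1 = true ∧ l.2.2.2 = true}).map (fun l => l.1)
  have hNB : ∀ B, MeasurableSet B → N B = (κ {l | l.2.2.1 = true})⁻¹ *
      κ {l | l.1 ∈ B ∧ l.2.2.1 = true ∧ l.2.2.2 = true} := by
    intro B hB
    rw [Measure.smul_apply, smul_eq_mul, Measure.map_apply measurable_fst hB,
      Measure.restrict_apply (measurable_fst hB)]
    rfl
  have hmass : N univ = ENNReal.ofReal p := by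
    rw [hNB univ MeasurableSet.univ]
    have : κ {l | l.1 ∈ univ ∧ l.2.2.1 = true ∧ l.2.2.2 = true} = κ {l | l.2.2.2 = true} := by
      refine measure_congr ?_
      filter_upwards [hmono] with l hl
      refine propext ⟨fun h => h.2.2, fun h => ⟨mem_univ _, Bool.le_iff_imp.1 hl h, h⟩⟩
    rw [this, ← hp, ← mul_assoc, ENNReal.inv_mul_cancel hsel htop, one_mul]
  refine ⟨N, ?_, hmass, alwaysObservedLaw_prod δ κ (fun B hB => ?_) hmass hsel⟩
  · refine Measure.le_iff.2 fun B hB => ?_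
    rw [hNB B hB, Measure.map_apply measurable_fst hB,
      cond_apply (measurableSet_bool_eq (by fun_prop) true)]
    gcongr
    exact fun l hl => ⟨hl.2.1, hl.1⟩
  · rw [hNB B hB, ← mul_assoc, ENNReal.mul_inv_cancel hsel htop, one_mul]

/-- Every subprobability with density at most one and the right mass arises from a law of the
potential variables that is observationally equivalent to the given one. -/
theorem exists_latentLaw_of_le [Nonempty 𝒴] (δ : Measure Bool) [IsProbabilityMeasure δ]
    {κ : Measure (𝒴 × 𝒴 × Bool × Bool)} [IsProbabilityMeasure κ] {p : ℝ}
    (hsel0 : κ {l | l.2.2.2 = true} ≠ 0) (hsel : κ {l | l.2.2.1 = true} ≠ 0)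
    (hp : κ {l | l.2.2.1 = true} * ENNReal.ofReal p = κ {l | l.2.2.2 = true})
    {N : Measure 𝒴} (hN : N ≤ (κ[|{l | l.2.2.1 = true}]).map (fun l => l.1))
    (hmass : N univ = ENNReal.ofReal p) :
    ∃ γ ∈ selectionModel 𝒴, observedLaw γ = observedLaw (δ.prod κ) ∧
      alwaysObservedLaw γ = (ENNReal.ofReal p)⁻¹ • N := by
  obtain ⟨y⟩ := ‹Nonempty 𝒴›
  let c := κ {l | l.2.2.1 = true}
  have hc1 : c ≤ 1 := prob_le_one
  have hctop : c ≠ ∞ := measure_ne_top _ _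
  let ρ₁ := (κ[|{l | l.2.2.1 = true}]).map (fun l => l.1)
  let ρ₀ := (κ[|{l | l.2.2.2 = true}]).map (fun l => l.2.1)
  have hρ₁ : IsProbabilityMeasure ρ₁ :=
    have := cond_isProbabilityMeasure (μ := κ) hsel
    Measure.isProbabilityMeasure_map (by fun_prop)
  have hρ₀ : IsProbabilityMeasure ρ₀ :=
    have := cond_isProbabilityMeasure (μ := κ) hsel0
    Measure.isProbabilityMeasure_map (by fun_prop)
  have hNfin : IsFiniteMeasure N := isFiniteMeasure_of_le ρ₁ hN
  have hsum : ∀ B, N B + (ρ₁ - N) B = ρ₁ B := fun B => by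
    rw [← Measure.add_apply, add_comm, Measure.sub_add_cancel_of_le hN]
  -- `f` places the always selected and `g` those selected only if treated. The filler `y` stands
  -- where a potential outcome is never observed.
  let f : 𝒴 × 𝒴 → 𝒴 × 𝒴 × Bool × Bool := fun z => (z.1, z.2, true, true)
  let g : 𝒴 → 𝒴 × 𝒴 × Bool × Bool := fun z => (z, y, true, false)
  have hf : Measurable f := by fun_prop
  have hg : Measurable g := by fun_prop
  -- The strata have masses `c p`, `c (1 - p)` and `1 - c`. In the treated arm `N` and `ρ₁ - N` add
  -- up to `ρ₁`; in the control arm only the first stratum is selected, with outcome law `ρ₀` and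
  -- mass `c p = κ {S₀ = 1}`.
  let κ' : Measure (𝒴 × 𝒴 × Bool × Bool) := c • (N.prod ρ₀).map f + c • (ρ₁ - N).map g +
    (1 - c) • Measure.dirac (y, y, false, false)
  have hκ' : ∀ T, MeasurableSet T → κ' T = c * (N.prod ρ₀) (f ⁻¹' T) + c * (ρ₁ - N) (g ⁻¹' T) +
      (1 - c) * T.indicator 1 (y, y, false, false) := by
    intro T hT
    simp only [κ', Measure.add_apply, Measure.smul_apply, smul_eq_mul, Measure.map_apply hf hT,
      Measure.map_apply hg hT, Measure.dirac_apply' _ hT]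
  have hT1 : MeasurableSet {l : 𝒴 × 𝒴 × Bool × Bool | l.2.2.1 = true} :=
    measurableSet_bool_eq (by fun_prop) true
  have hT0 : MeasurableSet {l : 𝒴 × 𝒴 × Bool × Bool | l.2.2.2 = true} :=
    measurableSet_bool_eq (by fun_prop) true
  have hprob : IsProbabilityMeasure κ' := ⟨by
    rw [hκ' _ MeasurableSet.univ, preimage_univ, preimage_univ, ← univ_prod_univ,
      Measure.prod_prod, measure_univ (μ := ρ₀), mul_one, ← mul_add, hsum, measure_univ]
    simp [hc1]⟩
  have hfst : ∀ B : Set 𝒴, (N.prod ρ₀) {z | z.1 ∈ B} = N B := fun B => by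
    have : {z : 𝒴 × 𝒴 | z.1 ∈ B} = B ×ˢ univ := by
      ext z
      simp
    rw [this, Measure.prod_prod, measure_univ, mul_one]
  have hsnd : ∀ B : Set 𝒴, (N.prod ρ₀) {z | z.2 ∈ B} = ENNReal.ofReal p * ρ₀ B := fun B => by
    have : {z : 𝒴 × 𝒴 | z.2 ∈ B} = univ ×ˢ B := by
      ext z
      simp
    rw [this, Measure.prod_prod, hmass]
  have h1 : ∀ B, MeasurableSet B →
      κ' {l | l.1 ∈ B ∧ l.2.2.1 = true} = κ {l | l.1 ∈ B ∧ l.2.2.1 = true} := by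
    intro B hB
    rw [hκ' {l | l.1 ∈ B ∧ l.2.2.1 = true} ((measurable_fst hB).inter hT1)]
    simp only [f, g, preimage_ofPred_eq, and_true, hfst, ofPred_mem_eq]
    rw [← mul_add, hsum, Measure.map_apply measurable_fst hB, cond_apply hT1, ← mul_assoc,
      ENNReal.mul_inv_cancel hsel hctop, one_mul, inter_comm]
    simp
    rfl
  have h0 : ∀ B, MeasurableSet B →
      κ' {l | l.2.1 ∈ B ∧ l.2.2.2 = true} = κ {l | l.2.1 ∈ B ∧ l.2.2.2 = true} := by
    intro B hB
    have hB' : MeasurableSet {l : 𝒴 × 𝒴 × Bool × Bool | l.2.1 ∈ B} :=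
      (measurable_fst.comp measurable_snd) hB
    rw [hκ' {l | l.2.1 ∈ B ∧ l.2.2.2 = true} (hB'.inter hT0)]
    simp only [f, g, preimage_ofPred_eq, and_true, hsnd]
    rw [← mul_assoc, hp, Measure.map_apply (by fun_prop) hB, cond_apply hT0, ← mul_assoc,
      ENNReal.mul_inv_cancel hsel0 (measure_ne_top _ _), one_mul, inter_comm]
    simp
    rfl
  have hmono' : ∀ᵐ l ∂κ', l.2.2.2 ≤ l.2.2.1 := by
    change κ' {l | l.2.2.2 ≤ l.2.2.1}ᶜ = 0
    rw [hκ' _ measurableSet_monotone.compl]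
    simp [f, g]
  refine ⟨δ.prod κ', mem_selectionModel_iff.2 ⟨δ, κ', inferInstance, hprob, rfl, hmono'⟩,
    observedLaw_prod_congr δ h1 h0, alwaysObservedLaw_prod δ κ' (fun B hB => ?_) hmass ?_⟩
  · have hc' : κ' {l | l.2.2.1 = true} = c := by
      simpa using h1 univ MeasurableSet.univ
    rw [hc', hκ' {l | l.1 ∈ B ∧ l.2.2.1 = true ∧ l.2.2.2 = true}
      ((measurable_fst hB).inter (hT1.inter hT0))]
    simp [f, g, hfst]
  · have hc' : κ' {l | l.2.2.1 = true} = c := by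
      simpa using h1 univ MeasurableSet.univ
    rw [hc']
    exact hsel
end

/-! ### Fréchet means through the embedding. -/

section
variable {𝒴 : Type*} [MetricSpace 𝒴] [MeasurableSpace 𝒴]
variable {H : Type*} [NormedAddCommGroup H] [InnerProductSpace ℝ H] [CompleteSpace H]

/-- The bias-variance decomposition of the Fréchet functional. -/
theorem lintegral_edist_sq_eq {Ψ : 𝒴 → H} (hΨ : Isometry Ψ) {ρ : Measure 𝒴}
    [IsProbabilityMeasure ρ] (hmem : MemLp Ψ 2 ρ) (z : 𝒴) :
    ∫⁻ w, edist z w ^ 2 ∂ρ = ENNReal.ofReal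
      (‖Ψ z - ∫ y, Ψ y ∂ρ‖ ^ 2 + ∫ w, ‖(∫ y, Ψ y ∂ρ) - Ψ w‖ ^ 2 ∂ρ) := by
  set m := ∫ y, Ψ y ∂ρ with hm
  have hint : Integrable Ψ ρ := hmem.integrable (by norm_num)
  have hsub : ∀ a : H, MemLp (fun w => a - Ψ w) 2 ρ := fun a => (memLp_const a).sub hmem
  have hsq : ∀ a : H, Integrable (fun w => ‖a - Ψ w‖ ^ 2) ρ := fun a =>
    (memLp_two_iff_integrable_sq_norm (hsub a).1).1 (hsub a)
  have hpoint : ∀ w, edist z w ^ 2 = ENNReal.ofReal (‖Ψ z - Ψ w‖ ^ 2) := fun w => by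
    rw [← hΨ.edist_eq, edist_dist, dist_eq_norm, ENNReal.ofReal_pow (norm_nonneg _)]
  -- The cross term vanishes because `m` is the mean.
  have hcross : ∫ w, inner ℝ (Ψ z - m) (m - Ψ w) ∂ρ = 0 := by
    rw [integral_inner ((hsub m).integrable (by norm_num)),
      integral_sub (integrable_const m) hint]
    simp [hm]
  simp_rw [hpoint]
  rw [← ofReal_integral_eq_lintegral_ofReal (hsq _) (Filter.Eventually.of_forall fun _ => by
    positivity)]
  congr 1
  have hexp : ∀ w, ‖Ψ z - Ψ w‖ ^ 2 =
      ‖Ψ z - m‖ ^ 2 + 2 * inner ℝ (Ψ z - m) (m - Ψ w) + ‖m - Ψ w‖ ^ 2 := fun w => by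
    rw [← norm_add_sq_real, sub_add_sub_cancel]
  have hci : Integrable (fun w => 2 * inner ℝ (Ψ z - m) (m - Ψ w)) ρ :=
    (((hsub m).integrable (by norm_num)).const_inner _).const_mul 2
  simp_rw [hexp]
  have hsum : Integrable (fun w => ‖Ψ z - m‖ ^ 2 + 2 * inner ℝ (Ψ z - m) (m - Ψ w)) ρ :=
    (integrable_const _).add hci
  rw [integral_add hsum (hsq m), integral_add (integrable_const _) hci,
    integral_const_mul, hcross]
  simp

variable {Ψ : 𝒴 → H} (hΨ : Isometry Ψ) (hclosed : IsClosed (range Ψ))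
  (hconv : Convex ℝ (range Ψ)) {ρ : Measure 𝒴} [IsProbabilityMeasure ρ] (hmem : MemLp Ψ 2 ρ)

-- The mean of a law carried by a closed convex set stays in that set.
omit [MetricSpace 𝒴] in
include hclosed hconv hmem in
theorem exists_embed_eq_integral : ∃ y, Ψ y = ∫ w, Ψ w ∂ρ :=
  hconv.integral_mem hclosed (Filter.Eventually.of_forall fun w => mem_range_self w)
    (hmem.integrable (by norm_num))

include hΨ hclosed hconv hmem in
/-- The Fréchet mean is the point that is embedded into the mean of the embedded variable. -/
theorem isFrechetMean_iff (y : 𝒴) : IsFrechetMean ρ y ↔ Ψ y = ∫ w, Ψ w ∂ρ := by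
  have hvar : 0 ≤ ∫ w, ‖(∫ y, Ψ y ∂ρ) - Ψ w‖ ^ 2 ∂ρ := integral_nonneg fun _ => by positivity
  simp only [IsFrechetMean, lintegral_edist_sq_eq hΨ hmem]
  constructor
  · intro h
    obtain ⟨y₀, hy₀⟩ := exists_embed_eq_integral hclosed hconv hmem
    have := h y₀
    rw [hy₀, ENNReal.ofReal_le_ofReal_iff (by positivity)] at this
    simp only [sub_self, norm_zero] at this
    have hnorm : ‖Ψ y - ∫ w, Ψ w ∂ρ‖ ^ 2 = 0 :=
      le_antisymm (by linarith) (by positivity)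
    exact sub_eq_zero.1 (norm_eq_zero.1 (pow_eq_zero_iff two_ne_zero |>.1 hnorm))
  · intro h z
    rw [h]
    refine ENNReal.ofReal_le_ofReal ?_
    simp only [sub_self, norm_zero]
    have := sq_nonneg ‖Ψ z - ∫ y, Ψ y ∂ρ‖
    linarith

include hΨ hclosed hconv hmem in
theorem existsUnique_isFrechetMean : ∃! y, IsFrechetMean ρ y := by
  obtain ⟨y, hy⟩ := exists_embed_eq_integral hclosed hconv hmem
  refine ⟨y, (isFrechetMean_iff hΨ hclosed hconv hmem y).2 hy, fun z hz => hΨ.injective ?_⟩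
  rw [hy, (isFrechetMean_iff hΨ hclosed hconv hmem z).1 hz]

include hΨ hclosed hconv hmem in
theorem embed_frechetMean [Nonempty 𝒴] : Ψ (frechetMean ρ) = ∫ w, Ψ w ∂ρ :=
  (isFrechetMean_iff hΨ hclosed hconv hmem _).1
    (Classical.epsilon_spec (existsUnique_isFrechetMean hΨ hclosed hconv hmem).exists)

end

/-! ### Domination of measures along a measurable embedding. -/

section
variable {α β : Type*} [MeasurableSpace α] [MeasurableSpace β] {φ : α → β}

theorem map_le_map_iff (hφ : MeasurableEmbedding φ) {N ρ : Measure α} :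
    N.map φ ≤ ρ.map φ ↔ N ≤ ρ := by
  refine ⟨fun h => Measure.le_iff.2 fun B hB => ?_, fun h => Measure.map_mono h hφ.measurable⟩
  have := h (φ '' B)
  rwa [hφ.map_apply, hφ.map_apply, hφ.injective.preimage_image] at this

/-- A measure dominated by a pushforward is carried by the range of `φ`, so pulling it back loses no
mass. -/
theorem exists_eq_map_of_le_map (hφ : MeasurableEmbedding φ) {ρ : Measure α} {ν : Measure β}
    (hν : ν ≤ ρ.map φ) : ∃ N ≤ ρ, N.map φ = ν := by
  have hmap : (ν.comap φ).map φ = ν := by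
    rw [hφ.map_comap, Measure.restrict_eq_self_of_ae_mem]
    refine Measure.absolutelyContinuous_of_le hν ?_
    exact (ae_map_iff hφ.measurable.aemeasurable hφ.measurableSet_range).2
      (Filter.Eventually.of_forall fun a => mem_range_self a)
  exact ⟨ν.comap φ, (map_le_map_iff hφ).1 (hmap.symm ▸ hν), hmap⟩

end

/-! ### Sharp identified sets. -/

section
variable {𝒴 : Type*} [MeasurableSpace 𝒴]

/-- The structure of a parameter in the model when the conditioning events have positive
probability. -/
theorem exists_prod_of_mem_selectionModel {γ : Measure (Latent 𝒴)} (hγ : γ ∈ selectionModel 𝒴)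
    (hD₁ : observedLaw γ {o | o.1 = true} ≠ 0)
    (hD₀ : observedLaw γ {o | o.1 = false ∧ o.2.1 = true} ≠ 0) :
    ∃ (δ : Measure Bool) (κ : Measure (𝒴 × 𝒴 × Bool × Bool)),
      IsProbabilityMeasure δ ∧ IsProbabilityMeasure κ ∧ γ = δ.prod κ ∧
      (∀ᵐ l ∂κ, l.2.2.2 ≤ l.2.2.1) ∧ δ {true} ≠ 0 ∧ κ {l | l.2.2.2 = true} ≠ 0 ∧
      κ {l | l.2.2.1 = true} ≠ 0 ∧ 0 < trimming (observedLaw γ) ∧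
      trimming (observedLaw γ) ≤ 1 ∧
      κ {l | l.2.2.1 = true} * ENNReal.ofReal (trimming (observedLaw γ)) =
        κ {l | l.2.2.2 = true} := by
  obtain ⟨δ, κ, hδ, hκ, rfl, hmono⟩ := mem_selectionModel_iff.1 hγ
  rw [observedLaw_prod_arm] at hD₁
  rw [observedLaw_prod_control] at hD₀
  -- The single assumption on `P(D = 0, S = 1)` gives positivity of both the control arm and the
  -- event `S₀ = 1`.
  obtain ⟨hf, h0⟩ := mul_ne_zero_iff.1 hD₀
  have hle := measure_control_le_treated hmono
  have h1 : κ {l | l.2.2.1 = true} ≠ 0 := (pos_iff_ne_zero.2 h0 |>.trans_le hle).ne'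
  have hp0 : 0 < κ.real {l | l.2.2.2 = true} := ENNReal.toReal_pos h0 (measure_ne_top _ _)
  have hp1 : 0 < κ.real {l | l.2.2.1 = true} := ENNReal.toReal_pos h1 (measure_ne_top _ _)
  refine ⟨δ, κ, hδ, hκ, rfl, hmono, hD₁, h0, h1, ?_⟩
  rw [trimming_observedLaw_prod δ κ hD₁ hf]
  refine ⟨by positivity, div_le_one_of_le₀ (ENNReal.toReal_mono (measure_ne_top _ _) hle) hp1.le,
    ?_⟩
  rw [ENNReal.ofReal_div_of_pos hp1, ofReal_measureReal, ofReal_measureReal,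
    ENNReal.mul_div_cancel h1 (measure_ne_top _ _)]

theorem isProbabilityMeasure_embeddedLaw {H : Type*} [NormedAddCommGroup H] [MeasurableSpace H]
    {Ψ : 𝒴 → H} (hΨ : Measurable Ψ) {P : Measure (Observed 𝒴)} [IsFiniteMeasure P]
    (hP : P {o | o.1 = true ∧ o.2.1 = true} ≠ 0) : IsProbabilityMeasure (embeddedLaw Ψ P) := by
  have hemb : Measurable (embedObserved Ψ) := hΨ.sumElim measurable_const
  have := cond_isProbabilityMeasure (μ := P) hP
  exact Measure.isProbabilityMeasure_map (by fun_prop)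

/-- Missing outcomes are embedded as `0`, so the assumption only concerns observed ones;
conditioning restricts `P` and rescales it by a finite constant. -/
theorem memLp_embeddedLaw {H : Type*} [NormedAddCommGroup H] [MeasurableSpace H] [BorelSpace H]
    [SecondCountableTopology H] {Ψ : 𝒴 → H} (hΨ : Measurable Ψ) {P : Measure (Observed 𝒴)}
    (hP : P {o | o.1 = true ∧ o.2.1 = true} ≠ 0)
    (hmoment : Integrable (fun o => ‖embedObserved Ψ o.2.2‖ ^ 2) P) :
    MemLp (fun x : H => x) 2 (embeddedLaw Ψ P) := by
  have hemb : Measurable (embedObserved Ψ) := hΨ.sumElim measurable_const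
  have hm : Measurable fun o : Observed 𝒴 => embedObserved Ψ o.2.2 := by fun_prop
  rw [memLp_two_iff_integrable_sq_norm measurable_id'.aestronglyMeasurable, embeddedLaw,
    integrable_map_measure (by fun_prop) hm.aemeasurable]
  exact hmoment.restrict.smul_measure (ENNReal.inv_ne_top.2 hP)

variable {H : Type*} [NormedAddCommGroup H] [InnerProductSpace ℝ H] [MeasurableSpace H]

omit [InnerProductSpace ℝ H] in
/-- The conditional laws of the treated outcome of the always-observed which are compatible with
the law of the data. -/
theorem alwaysObservedLaw_image_eq [Nonempty 𝒴] {Ψ : 𝒴 → H} (hΨ : MeasurableEmbedding Ψ)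
    {γ₀ : Measure (Latent 𝒴)} (hγ₀ : γ₀ ∈ selectionModel 𝒴) {P : Measure (Observed 𝒴)}
    (hP : observedLaw γ₀ = P) (hD₁ : P {o | o.1 = true} ≠ 0)
    (hD₀ : P {o | o.1 = false ∧ o.2.1 = true} ≠ 0) :
    sharpIdentifiedSet (selectionModel 𝒴) observedLaw alwaysObservedLaw P =
      {ρ | ∃ N : Measure 𝒴, N.map Ψ ≤ embeddedLaw Ψ P ∧
        N univ = ENNReal.ofReal (trimming P) ∧ ρ = (ENNReal.ofReal (trimming P))⁻¹ • N} := by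
  ext ρ
  constructor
  · rintro ⟨γ, ⟨hγ, rfl⟩, rfl⟩
    obtain ⟨δ, κ, hδ, hκ, rfl, hmono, ht, -, h1, -, -, hp⟩ :=
      exists_prod_of_mem_selectionModel hγ hD₁ hD₀
    obtain ⟨N, hN, hmass, hlaw⟩ := exists_le_of_latentLaw δ hmono h1 hp
    refine ⟨N, ?_, hmass, hlaw⟩
    rw [embeddedLaw_observedLaw_prod δ κ hΨ.measurable ht]
    exact Measure.map_mono hN hΨ.measurable
  · rintro ⟨N, hN, hmass, rfl⟩
    subst hP
    obtain ⟨δ, κ, hδ, hκ, rfl, -, ht, h0, h1, -, -, hp⟩ :=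
      exists_prod_of_mem_selectionModel hγ₀ hD₁ hD₀
    rw [embeddedLaw_observedLaw_prod δ κ hΨ.measurable ht, map_le_map_iff hΨ] at hN
    obtain ⟨γ, hγ, hobs, hlaw⟩ := exists_latentLaw_of_le δ h0 h1 hp hN hmass
    exact ⟨γ, ⟨hγ, hobs⟩, hlaw⟩

theorem integral_inv_smul_eq {Ψ : 𝒴 → H} (hΨ : MeasurableEmbedding Ψ) {p : ℝ} (hp : 0 ≤ p)
    (N : Measure 𝒴) :
    ∫ y, Ψ y ∂((ENNReal.ofReal p)⁻¹ • N) = (1 / p) • ∫ x, x ∂(N.map Ψ) := by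
  rw [integral_smul_measure, hΨ.integral_map, ENNReal.toReal_inv, ENNReal.toReal_ofReal hp,
    one_div]

/-- `I₁` is the sharp identified set of the conditional mean. -/
theorem sharpIdentifiedSet_alwaysObservedMean [Nonempty 𝒴] {Ψ : 𝒴 → H}
    (hΨ : MeasurableEmbedding Ψ) {γ₀ : Measure (Latent 𝒴)} (hγ₀ : γ₀ ∈ selectionModel 𝒴)
    {P : Measure (Observed 𝒴)} (hP : observedLaw γ₀ = P) (hD₁ : P {o | o.1 = true} ≠ 0)
    (hD₀ : P {o | o.1 = false ∧ o.2.1 = true} ≠ 0) :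
    sharpIdentifiedSet (selectionModel 𝒴) observedLaw (alwaysObservedMean Ψ) P =
      setI (embeddedLaw Ψ P) (trimming P) := by
  have hp : 0 ≤ trimming P := div_nonneg measureReal_nonneg measureReal_nonneg
  -- The mean is a functional of the conditional law, so its identified set is the image of that of
  -- the law.
  have hcomp : sharpIdentifiedSet (selectionModel 𝒴) observedLaw (alwaysObservedMean Ψ) P =
      (fun ρ : Measure 𝒴 => ∫ y, Ψ y ∂ρ) ''
        sharpIdentifiedSet (selectionModel 𝒴) observedLaw alwaysObservedLaw P := by
    rw [sharpIdentifiedSet, sharpIdentifiedSet, image_image]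
    rfl
  rw [hcomp, alwaysObservedLaw_image_eq hΨ hγ₀ hP hD₁ hD₀]
  ext v
  rw [mem_setI_iff]
  constructor
  · rintro ⟨_, ⟨N, hN, hmass, rfl⟩, rfl⟩
    refine ⟨N.map Ψ, hN, ?_, integral_inv_smul_eq hΨ hp N⟩
    rw [Measure.map_apply hΨ.measurable MeasurableSet.univ, preimage_univ, hmass]
  · rintro ⟨ν, hν, hmass, rfl⟩
    subst hP
    obtain ⟨δ, κ, hδ, hκ, rfl, -, ht, -⟩ := exists_prod_of_mem_selectionModel hγ₀ hD₁ hD₀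
    obtain ⟨N, -, rfl⟩ := exists_eq_map_of_le_map hΨ
      (embeddedLaw_observedLaw_prod δ κ hΨ.measurable ht ▸ hν)
    rw [Measure.map_apply hΨ.measurable MeasurableSet.univ, preimage_univ] at hmass
    exact ⟨_, ⟨N, hν, hmass, rfl⟩, integral_inv_smul_eq hΨ hp N⟩

/-- `I₁` is the sharp identified set in the mixture model. -/
theorem sharpIdentifiedSet_mixtureModel (μ : Measure H) [IsProbabilityMeasure μ] (p : ℝ) :
    sharpIdentifiedSet (mixtureModel H p) (fun γ => γ.1 + γ.2)
      (fun γ => (1 / p) • ∫ x, x ∂γ.1) μ = setI μ p := by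
  ext v
  rw [mem_setI_iff]
  constructor
  · rintro ⟨γ, ⟨hγ, rfl⟩, rfl⟩
    exact ⟨γ.1, Measure.le_add_right le_rfl, hγ.2, rfl⟩
  · rintro ⟨ν, hν, hmass, rfl⟩
    have : IsFiniteMeasure ν := isFiniteMeasure_of_le μ hν
    have hsum : ν + (μ - ν) = μ := by rw [add_comm, Measure.sub_add_cancel_of_le hν]
    -- The second mixture component is whatever `ν` leaves of `μ`.
    refine ⟨(ν, μ - ν), ⟨⟨?_, hmass⟩, hsum⟩, rfl⟩
    simpa only [hsum]

end

theorem measurableEmbedding_of_isometry {𝒴 H : Type*} [MetricSpace 𝒴] [MeasurableSpace 𝒴]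
    [BorelSpace 𝒴] [NormedAddCommGroup H] [MeasurableSpace H] [BorelSpace H] {Ψ : 𝒴 → H}
    (hΨ : Isometry Ψ) (hclosed : IsClosed (range Ψ)) : MeasurableEmbedding Ψ :=
  Topology.IsClosedEmbedding.measurableEmbedding ⟨hΨ.isEmbedding, hclosed⟩

/-- The conditional law of the treated outcome of the always-observed is a probability measure
with a finite second moment. -/
theorem alwaysObservedLaw_spec {𝒴 H : Type*} [Nonempty 𝒴] [MeasurableSpace 𝒴]
    [NormedAddCommGroup H] [MeasurableSpace H] {Ψ : 𝒴 → H} (hΨ : MeasurableEmbedding Ψ)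
    {γ : Measure (Latent 𝒴)} (hγ : γ ∈ selectionModel 𝒴)
    (hD₁ : observedLaw γ {o | o.1 = true} ≠ 0)
    (hD₀ : observedLaw γ {o | o.1 = false ∧ o.2.1 = true} ≠ 0)
    (hμ : MemLp (fun x : H => x) 2 (embeddedLaw Ψ (observedLaw γ))) :
    IsProbabilityMeasure (alwaysObservedLaw γ) ∧ MemLp Ψ 2 (alwaysObservedLaw γ) := by
  obtain ⟨-, -, -, -, -, -, -, -, -, hp, -⟩ := exists_prod_of_mem_selectionModel hγ hD₁ hD₀
  have hmem : alwaysObservedLaw γ ∈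
      sharpIdentifiedSet (selectionModel 𝒴) observedLaw alwaysObservedLaw (observedLaw γ) :=
    ⟨γ, ⟨hγ, rfl⟩, rfl⟩
  rw [alwaysObservedLaw_image_eq hΨ hγ rfl hD₁ hD₀] at hmem
  obtain ⟨N, hN, hmass, hlaw⟩ := hmem
  have hp' := (ENNReal.ofReal_pos.2 hp).ne'
  rw [hlaw]
  refine ⟨⟨?_⟩, ?_⟩
  · rw [Measure.smul_apply, hmass, smul_eq_mul, ENNReal.inv_mul_cancel hp' ENNReal.ofReal_ne_top]
  -- Domination by `μ` transfers the second moment to `N`; since `p > 0`, rescaling by `1 / p` keeps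
  -- it finite.
  · exact (hΨ.memLp_map_measure_iff.1 (hμ.mono_measure hN)).smul_measure (ENNReal.inv_ne_top.2 hp')

/-- The identified set of the Fréchet mean is the preimage of that of the mean. -/
theorem sharpIdentifiedSet_frechetMean {𝒴 H : Type*} [MetricSpace 𝒴] [Nonempty 𝒴]
    [MeasurableSpace 𝒴] [NormedAddCommGroup H] [InnerProductSpace ℝ H]
    [CompleteSpace H] {Γ Q : Type*} {model : Set Γ} {law : Γ → Q} {P : Q}
    {ρ : Γ → Measure 𝒴} {Ψ : 𝒴 → H} (hΨ : Isometry Ψ) (hclosed : IsClosed (range Ψ))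
    (hconv : Convex ℝ (range Ψ))
    (hρ : ∀ γ ∈ model, law γ = P → IsProbabilityMeasure (ρ γ) ∧ MemLp Ψ 2 (ρ γ)) :
    sharpIdentifiedSet model law (fun γ => frechetMean (ρ γ)) P =
      Ψ ⁻¹' sharpIdentifiedSet model law (fun γ => ∫ y, Ψ y ∂(ρ γ)) P := by
  have hmean : ∀ γ ∈ model, law γ = P → Ψ (frechetMean (ρ γ)) = ∫ y, Ψ y ∂(ρ γ) := by
    intro γ hγ hP
    obtain ⟨hprob, hmem⟩ := hρ γ hγ hP
    exact embed_frechetMean hΨ hclosed hconv hmem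
  ext y
  constructor
  · rintro ⟨γ, hγ, rfl⟩
    exact ⟨γ, hγ, (hmean γ hγ.1 hγ.2).symm⟩
  · rintro ⟨γ, hγ, hy⟩
    exact ⟨γ, hγ, hΨ.injective ((hmean γ hγ.1 hγ.2).trans hy)⟩

theorem exists_mem_selectionModel_of_indepFun {Ω : Type*} [MeasurableSpace Ω] {Pr : Measure Ω}
    [IsProbabilityMeasure Pr] {𝒴 : Type*} [MeasurableSpace 𝒴] {D : Ω → Bool} {Y₁ Y₀ : Ω → 𝒴}
    {S₁ S₀ : Ω → Bool} (hD : Measurable D)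
    (hL : Measurable fun ω => (Y₁ ω, Y₀ ω, S₁ ω, S₀ ω))
    (hassign : IndepFun D (fun ω => (Y₁ ω, Y₀ ω, S₁ ω, S₀ ω)) Pr)
    (hmono : ∀ᵐ ω ∂Pr, S₀ ω ≤ S₁ ω) {P : Measure (Observed 𝒴)}
    (hP : P = Pr.map (fun ω => observe (D ω, Y₁ ω, Y₀ ω, S₁ ω, S₀ ω))) :
    ∃ γ ∈ selectionModel 𝒴, observedLaw γ = P := by
  refine ⟨Pr.map fun ω => (D ω, Y₁ ω, Y₀ ω, S₁ ω, S₀ ω), mem_selectionModel_iff.2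
    ⟨Pr.map D, Pr.map fun ω => (Y₁ ω, Y₀ ω, S₁ ω, S₀ ω),
      Measure.isProbabilityMeasure_map hD.aemeasurable,
      Measure.isProbabilityMeasure_map hL.aemeasurable,
      (indepFun_iff_map_prod_eq_prod_map_map hD.aemeasurable hL.aemeasurable).1 hassign,
      (ae_map_iff hL.aemeasurable measurableSet_monotone).2 hmono⟩, ?_⟩
  rw [observedLaw, Measure.map_map measurable_observe (hD.prodMk hL), hP]
  rfl

end LeeBounds

end

/-! ### The theorem. -/

theorem mainTheorem1
    {Ω : Type*} [MeasurableSpace Ω] (Pr : Measure Ω) [IsProbabilityMeasure Pr]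
    {𝒴 : Type*} [MetricSpace 𝒴] [Nonempty 𝒴] [MeasurableSpace 𝒴] [BorelSpace 𝒴]
    {H : Type*} [NormedAddCommGroup H] [InnerProductSpace ℝ H] [CompleteSpace H]
    [TopologicalSpace.SeparableSpace H] [MeasurableSpace H] [BorelSpace H]
    -- treatment, potential outcomes, potential selection indicators
    (D : Ω → Bool) (Y₁ Y₀ : Ω → 𝒴) (S₁ S₀ : Ω → Bool)
    (hD : Measurable D) (hY₁ : Measurable Y₁) (hY₀ : Measurable Y₀)
    (hS₁ : Measurable S₁) (hS₀ : Measurable S₀)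
    -- random assignment and monotonicity
    (hassign : IndepFun D (fun ω => (Y₁ ω, Y₀ ω, S₁ ω, S₀ ω)) Pr)
    (hmono : ∀ᵐ ω ∂Pr, S₀ ω ≤ S₁ ω)
    -- the law of the observed vector `(D, S, Y)`
    (P : Measure (LeeBounds.Observed 𝒴))
    (hP : P = Pr.map (fun ω => LeeBounds.observe (D ω, Y₁ ω, Y₀ ω, S₁ ω, S₀ ω)))
    -- the events that are conditioned on have positive probability
    (hD₁ : P {o | o.1 = true} ≠ 0)
    (hD₀ : P {o | o.1 = false ∧ o.2.1 = true} ≠ 0)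
    -- the embedding
    (Ψ : 𝒴 → H) (hΨ : Isometry Ψ) (hΨ_closed : IsClosed (range Ψ))
    (hΨ_convex : Convex ℝ (range Ψ))
    -- second moment
    (hmoment : Integrable (fun o => ‖LeeBounds.embedObserved Ψ o.2.2‖ ^ 2) P)
    -- `p`, and the law `μ` of `Ψ(Y)` given `D = 1` and `S = 1`
    (p : ℝ) (hp : p = LeeBounds.trimming P)
    (μ : Measure H) (hμ : μ = LeeBounds.embeddedLaw Ψ P)
    -- the law of `⟨u, Ψ(Y)⟩` given `D = 1` and `S = 1` is continuous
    (hcont : ∀ u : H, ‖u‖ = 1 → ∀ c : ℝ, μ {x | inner ℝ u x = c} = 0) :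
    -- `I₁` is the sharp identified set of `E[Ψ(Y₁) | S₁ = S₀ = 1]`
    (LeeBounds.IsSharpIdentifiedSet (LeeBounds.selectionModel 𝒴) LeeBounds.observedLaw
        (LeeBounds.alwaysObservedMean Ψ) P (LeeBounds.setI μ p) ∧
      LeeBounds.IsSharpIdentifiedSet (LeeBounds.mixtureModel H p) (fun γ => γ.1 + γ.2)
        (fun γ => (1 / p) • ∫ x, x ∂γ.1) μ (LeeBounds.setI μ p)) ∧
    -- (i)
    (closure (convexHull ℝ (LeeBounds.setI μ p)) = LeeBounds.setS μ p ∧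
      LeeBounds.IsValidIdentifiedSet (LeeBounds.selectionModel 𝒴) LeeBounds.observedLaw
        (LeeBounds.alwaysObservedMean Ψ) P (LeeBounds.setS μ p)) ∧
    -- (ii)
    ((∀ γ ∈ LeeBounds.selectionModel 𝒴, LeeBounds.observedLaw γ = P →
        ∃! y, LeeBounds.IsFrechetMean (LeeBounds.alwaysObservedLaw γ) y) ∧
      LeeBounds.IsValidIdentifiedSet (LeeBounds.selectionModel 𝒴) LeeBounds.observedLaw
        LeeBounds.alwaysObservedFrechetMean P (Ψ ⁻¹' LeeBounds.setS μ p)) ∧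
    -- (iii)
    ((∃ V : Submodule ℝ H, FiniteDimensional ℝ V ∧ ∀ᵐ x ∂μ, x ∈ V) →
      LeeBounds.setI μ p = LeeBounds.setS μ p ∧
      LeeBounds.IsSharpIdentifiedSet (LeeBounds.selectionModel 𝒴) LeeBounds.observedLaw
        (LeeBounds.alwaysObservedMean Ψ) P (LeeBounds.setS μ p) ∧
      LeeBounds.IsSharpIdentifiedSet (LeeBounds.selectionModel 𝒴) LeeBounds.observedLaw
        LeeBounds.alwaysObservedFrechetMean P (Ψ ⁻¹' LeeBounds.setS μ p)) := by 
  obtain ⟨γ₀, hγ₀, hobs⟩ : ∃ γ₀ ∈ LeeBounds.selectionModel 𝒴, LeeBounds.observedLaw γ₀ = P :=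
    LeeBounds.exists_mem_selectionModel_of_indepFun hD (hY₁.prodMk (hY₀.prodMk (hS₁.prodMk hS₀)))
      hassign hmono hP
  have hemb := LeeBounds.measurableEmbedding_of_isometry hΨ hΨ_closed
  have hprobP : IsProbabilityMeasure P := by
    have := hγ₀.1
    rw [← hobs]
    exact Measure.isProbabilityMeasure_map LeeBounds.measurable_observe.aemeasurable
  obtain ⟨hsel, hp0, hp1⟩ : P {o | o.1 = true ∧ o.2.1 = true} ≠ 0 ∧ 0 < p ∧ p ≤ 1 := by
    rw [hp]
    subst hobs
    obtain ⟨δ, κ, hδ, hκ, rfl, -, ht, -, h1, hp0, hp1, -⟩ :=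
      LeeBounds.exists_prod_of_mem_selectionModel hγ₀ hD₁ hD₀
    rw [LeeBounds.observedLaw_prod_treated]
    exact ⟨mul_ne_zero ht h1, hp0, hp1⟩
  have hprobμ : IsProbabilityMeasure μ :=
    hμ ▸ LeeBounds.isProbabilityMeasure_embeddedLaw hemb.measurable hsel
  have hmem : MemLp (fun x : H => x) 2 μ :=
    hμ ▸ LeeBounds.memLp_embeddedLaw hemb.measurable hsel hmoment
  have hspec : ∀ γ ∈ LeeBounds.selectionModel 𝒴, LeeBounds.observedLaw γ = P →
      IsProbabilityMeasure (LeeBounds.alwaysObservedLaw γ) ∧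
        MemLp Ψ 2 (LeeBounds.alwaysObservedLaw γ) := by
    rintro γ hγ hγP
    refine LeeBounds.alwaysObservedLaw_spec hemb hγ ?_ ?_ ?_ <;> rw [hγP]
    · exact hD₁
    · exact hD₀
    · exact hμ ▸ hmem
  -- This equality carries each statement about `I₁` over to `S₁`, so the identification results
  -- below apply to `S₁` directly.
  have hIS : LeeBounds.setI μ p = LeeBounds.setS μ p :=
    LeeBounds.setI_eq_setS hmem hp0 hp1 hcont
  have hmean : LeeBounds.IsSharpIdentifiedSet (LeeBounds.selectionModel 𝒴) LeeBounds.observedLaw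
      (LeeBounds.alwaysObservedMean Ψ) P (LeeBounds.setI μ p) := by
    rw [hμ, hp]
    exact (LeeBounds.sharpIdentifiedSet_alwaysObservedMean hemb hγ₀ hobs hD₁ hD₀).symm
  have hfrechet : LeeBounds.IsSharpIdentifiedSet (LeeBounds.selectionModel 𝒴)
      LeeBounds.observedLaw LeeBounds.alwaysObservedFrechetMean P
      (Ψ ⁻¹' LeeBounds.setS μ p) := by
    rw [← hIS, hmean]
    exact (LeeBounds.sharpIdentifiedSet_frechetMean hΨ hΨ_closed hΨ_convex hspec).symm
  have hclosure : closure (convexHull ℝ (LeeBounds.setI μ p)) = LeeBounds.setI μ p := by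
    obtain ⟨hconv, hclosed⟩ := LeeBounds.convex_isClosed_setI hmem hp0
    rw [hconv.convexHull_eq, hclosed.closure_eq]
  have hmeanS := hIS ▸ hmean
  refine ⟨⟨hmean, (LeeBounds.sharpIdentifiedSet_mixtureModel μ p).symm⟩,
    ⟨hclosure.trans hIS, hmeanS.superset⟩, ⟨fun γ hγ hγP => ?_, hfrechet.superset⟩,
    fun _ => ⟨hIS, hmeanS, hfrechet⟩⟩
  obtain ⟨hprob, hmemγ⟩ := hspec γ hγ hγP
  exact LeeBounds.existsUnique_isFrechetMean hΨ hΨ_closed hΨ_convex hmemγ
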